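/- Let $n\ge 2$, $\sigma>0$, $\mu\in\mathbb{R}^n$ (not assumed to be monotone), and let $y=\mu+\xi$ with $\xi\sim\mathcal N(0,\sigma^2 I_{n\times n})$. Write $\|v\|_n^2=\frac1n\sum_{i=1}^n v_i^2$ for $v \in \mathbb{R}^n$, let $\mathcal S_n^\uparrow=\{u\in\mathbb{R}^n: u_1\le u_2\le\dots\le u_n\}$, and for $u\in\mathcal S_n^\uparrow$ let $k(u)=1+\#\{i\in\{1,\dots,n-1\}: u_i<u_{i+1}\}$ be the number of constant pieces of $u$. Let $\hat\mu=\hat\mu(y)\in\operatorname{argmin}_{u\in\mathcal S_n^\uparrow}\|y-u\|_n^2$ be the isotonic least squares estimator. Then $$\mathbb E\,\|\hat\mu-\mu\|_n^2\;\le\;\min_{u\in\mathcal S_n^\uparrow}\left(\|u-\mu\|_n^2+\frac{\sigma^2k(u)}{n}\log\frac{en}{k(u)}\right).$$ Furthermore, for every $x>0$, with probability at least $1-e^{-x}$, $$\|\hat\mu-\mu\|_n^2\;\le\;\min_{u\in\mathcal S_n^\uparrow}\left(\|u-\mu\|_n^2+\frac{2\sigma^2k(u)}{n}\log\frac{en}{k(u)}\right)+\frac{4\sigma^2x}{n}.$$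 Here both minima are attained and the expectation is finite. -/

import Mathlib

open MeasureTheory ProbabilityTheory

/-- The squared scaled norm `(1/n) * ∑ i, (u i)^2` on `ℝⁿ`. -/
noncomputable def scaledNormSq {n : ℕ} (u : EuclideanSpace ℝ (Fin n)) : ℝ :=
  (1 / (n : ℝ)) * ∑ i, (u i) ^ 2

/-- The set of nondecreasing sequences `u 0 ≤ u 1 ≤ ... ≤ u (n-1)`. -/
def nondecreasingSeq (n : ℕ) : Set (EuclideanSpace ℝ (Fin n)) :=
  {u | ∀ i j : Fin n, (j : ℕ) = (i : ℕ) + 1 → u i ≤ u j}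

/-- For a nondecreasing `u`, the number of constant pieces of `u`: one plus the number of indices
`i` such that the inequality between `u i` and its successor is strict. -/
noncomputable def numPieces {n : ℕ} (u : EuclideanSpace ℝ (Fin n)) : ℕ :=
  {i : Fin n | ∃ j : Fin n, (j : ℕ) = (i : ℕ) + 1 ∧ u i < u j}.ncard + 1

/-- The set of minimizers over `v ∈ K` of the least squares criterion `scaledNormSq (y - v)`. -/
def leastSquaresArgmin {n : ℕ} (K : Set (EuclideanSpace ℝ (Fin n)))
    (y : EuclideanSpace ℝ (Fin n)) : Set (EuclideanSpace ℝ (Fin n)) :=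
  {v | v ∈ K ∧ ∀ u ∈ K, scaledNormSq (y - v) ≤ scaledNormSq (y - u)}

/-!
The proof has a deterministic and a probabilistic half.

*Deterministic.* Let `v` be the least squares estimate and `u` any nondecreasing vector. The
variational inequality for `v` bounds the excess of `‖v - μ‖ ^ 2` over `‖u - μ‖ ^ 2` by
`2⟪ξ, h⟫ - ‖h‖ ^ 2` with `h = v - u`. As `h` is nondecreasing on each piece of `u`, this is at most
the sum over the pieces of `isoGain`, the squared norm of the projection of the noise on that piece
onto the cone of nondecreasing vectors (`scaledNormSq_sub_le`).

*Probabilistic.* Everything follows from a sharp bound on the exponential moment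
`A m = E exp (t * isoGain m)` for `m` standard Gaussian variables, `0 ≤ t < 1 / 2`. The projection
is constant on the faces of the greatest convex minorant of the random walk with these increments.
Each index lies in a face, so `m * A m` is at most the expected sum, over all faces, of the length
`k` of the face times the exponential. The gain splits into the gain of the sequence without the
face and the contribution of the mean of the face. Conversely, given a block of length `k` and
a sequence of length `m - k`, at most one cyclic shift of the block and at most one place of
insertion make the block a face (`isFace_insertShift_unique`). As the law of the increments is
invariant under rearrangements, this gives
`m * A m ≤ s * ∑ i < m, A i` with `s = 1 / √(1 - 2 * t)`, the exponential moment of the square of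
a single Gaussian variable (`mul_expGain_le`). Hence
`A m ≤ ∏ i ≤ m, (1 + (s - 1) / i) ≤ exp ((s - 1) * (1 + log m))`.

By independence and Jensen's inequality, the gain summed over the `k` pieces of `u` has
exponential moment at most `exp ((s - 1) * L)`, where `L = k * log (e * n / k)`
(`lintegral_exp_pieceGain_le`). Letting `t → 0`, where `s - 1 ~ t`, bounds its mean by `L`.
Markov's inequality at `t = 1 / 4`, where `s - 1 = √2 - 1 ≤ 1 / 2`, bounds it by `2 * L + 4 * x`
outside an event of probability `exp (-x)`.
-/

/-! ### The gain of a monotone fit -/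

/-- The decrease of the squared error `∑ l < m, (x l) ^ 2` when the first `m` terms of `x` are
fitted by those of `v`. -/
def quadGain (m : ℕ) (x v : ℕ → ℝ) : ℝ := ∑ l ∈ Finset.range m, (2 * x l * v l - v l ^ 2)

/-- The largest gain of a monotone fit to the first `m` terms of `x`; it is the squared norm of the
projection of `(x 0, …, x (m - 1))` onto the cone of nondecreasing vectors. -/
noncomputable def isoGain (m : ℕ) (x : ℕ → ℝ) : ℝ :=
  ⨆ v : {v : ℕ → ℝ // Monotone v}, quadGain m x v

/-- The random walk with increments `x`. -/
def walk (x : ℕ → ℝ) (i : ℕ) : ℝ := ∑ l ∈ Finset.range i, x l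

lemma quadGain_le_sum_sq (m : ℕ) (x v : ℕ → ℝ) :
    quadGain m x v ≤ ∑ l ∈ Finset.range m, x l ^ 2 :=
  Finset.sum_le_sum fun l _ => by nlinarith [sq_nonneg (x l - v l)]

lemma bddAbove_quadGain (m : ℕ) (x : ℕ → ℝ) :
    BddAbove (Set.range fun v : {v : ℕ → ℝ // Monotone v} => quadGain m x v) :=
  ⟨_, by rintro _ ⟨v, rfl⟩; exact quadGain_le_sum_sq m x v⟩

lemma quadGain_le_isoGain (m : ℕ) (x : ℕ → ℝ) {v : ℕ → ℝ} (hv : Monotone v) :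
    quadGain m x v ≤ isoGain m x :=
  le_ciSup (bddAbove_quadGain m x) ⟨v, hv⟩

lemma quadGain_congr {m : ℕ} {x x' v v' : ℕ → ℝ} (hx : ∀ l < m, x l = x' l)
    (hv : ∀ l < m, v l = v' l) : quadGain m x v = quadGain m x' v' :=
  Finset.sum_congr rfl fun l hl => by
    rw [hx l (Finset.mem_range.1 hl), hv l (Finset.mem_range.1 hl)]

lemma isoGain_congr {m : ℕ} {x x' : ℕ → ℝ} (hx : ∀ l < m, x l = x' l) :
    isoGain m x = isoGain m x' := by
  unfold isoGain
  congr 1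
  funext v
  exact quadGain_congr hx fun _ _ => rfl

lemma isoGain_nonneg (m : ℕ) (x : ℕ → ℝ) : 0 ≤ isoGain m x := by
  have h := quadGain_le_isoGain m x (v := fun _ => 0) monotone_const
  simpa [quadGain] using h

lemma isoGain_zero (x : ℕ → ℝ) : isoGain 0 x = 0 := by
  have : Nonempty {v : ℕ → ℝ // Monotone v} := ⟨⟨fun _ => 0, monotone_const⟩⟩
  simp [isoGain, quadGain]

lemma isClosed_setOf_monotone_fin (m : ℕ) :
    IsClosed {u : EuclideanSpace ℝ (Fin m) | ∀ i j, i ≤ j → u i ≤ u j} := by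
  simp only [Set.ofPred_forall]
  refine isClosed_iInter fun i => isClosed_iInter fun j => isClosed_iInter fun _ => ?_
  exact isClosed_le (by fun_prop) (by fun_prop)

lemma exists_isoGain_eq (m : ℕ) (x : ℕ → ℝ) :
    ∃ v, Monotone v ∧ isoGain m x = quadGain m x v := by
  rcases Nat.eq_zero_or_pos m with rfl | hm
  · exact ⟨fun _ => 0, monotone_const, by simp [isoGain_zero, quadGain]⟩
  obtain ⟨u, hu, hdist⟩ := (isClosed_setOf_monotone_fin m).exists_infDist_eq_dist
    ⟨0, fun i j _ => le_rfl⟩ (WithLp.toLp 2 fun i : Fin m => x i)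
  let v : ℕ → ℝ := fun l => u ⟨min l (m - 1), by omega⟩
  have hv : Monotone v := fun a b hab => hu _ _ (by
    simp only [Fin.mk_le_mk]; exact min_le_min_right _ hab)
  have hsq (w : ℕ → ℝ) : dist (WithLp.toLp 2 fun i : Fin m => x i)
      (WithLp.toLp 2 fun i : Fin m => w i) ^ 2
      = ∑ l ∈ Finset.range m, x l ^ 2 - quadGain m x w := by
    rw [EuclideanSpace.dist_eq, Real.sq_sqrt (by positivity), quadGain, ← Finset.sum_sub_distrib,
      Finset.sum_range]
    refine Finset.sum_congr rfl fun i _ => ?_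
    rw [Real.dist_eq, sq_abs]
    ring
  have huv : u = WithLp.toLp 2 fun i : Fin m => v i := by
    refine PiLp.ext fun i => ?_
    have hi : i = ⟨min i (m - 1), by omega⟩ := Fin.ext (by simp only; omega)
    exact congrArg (fun i => u i) hi
  refine ⟨v, hv, le_antisymm ?_ (quadGain_le_isoGain m x hv)⟩
  have : Nonempty {v : ℕ → ℝ // Monotone v} := ⟨⟨v, hv⟩⟩
  refine ciSup_le fun w => ?_
  have h1 := Metric.infDist_le_dist_of_mem (x := WithLp.toLp 2 fun i : Fin m => x i)
    (s := {u : EuclideanSpace ℝ (Fin m) | ∀ i j, i ≤ j → u i ≤ u j})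
    (y := WithLp.toLp 2 fun i : Fin m => w.1 i) (fun i j hij => w.2 hij)
  rw [hdist, huv] at h1
  have h2 := pow_le_pow_left₀ dist_nonneg h1 2
  rw [hsq, hsq] at h2
  linarith

lemma quadGain_add_smul (m : ℕ) (x v d : ℕ → ℝ) (t : ℝ) :
    quadGain m x (fun l => v l + t * d l) = quadGain m x v
      + 2 * t * ∑ l ∈ Finset.range m, (x l - v l) * d l
      - t ^ 2 * ∑ l ∈ Finset.range m, d l ^ 2 := by
  simp only [quadGain, Finset.mul_sum, ← Finset.sum_add_distrib, ← Finset.sum_sub_distrib]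
  exact Finset.sum_congr rfl fun l _ => by ring

/-- First order optimality of a best fit `v` in an admissible direction `d`. -/
lemma sum_sub_mul_nonpos {m : ℕ} {x v d : ℕ → ℝ} (hv : isoGain m x = quadGain m x v) {δ : ℝ}
    (hδ : 0 < δ) (hd : ∀ t, 0 < t → t < δ → Monotone fun l => v l + t * d l) :
    ∑ l ∈ Finset.range m, (x l - v l) * d l ≤ 0 := by
  by_contra! hc
  set c := ∑ l ∈ Finset.range m, (x l - v l) * d l
  set e := ∑ l ∈ Finset.range m, d l ^ 2
  have he : 0 ≤ e := Finset.sum_nonneg fun _ _ => sq_nonneg _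
  have key (t : ℝ) (h0 : 0 < t) (h1 : t < δ) : 2 * c ≤ t * e := by
    have h := quadGain_le_isoGain m x (hd t h0 h1)
    rw [hv, quadGain_add_smul] at h
    have h' : t * (2 * c) ≤ t * (t * e) := by linarith
    exact le_of_mul_le_mul_left h' h0
  have ht : 0 < min (δ / 2) (c / (e + 1)) := lt_min (by linarith) (by positivity)
  have h := key _ ht ((min_le_left _ _).trans_lt (by linarith))
  have h2 : min (δ / 2) (c / (e + 1)) * (e + 1) ≤ c := by
    calc _ ≤ c / (e + 1) * (e + 1) := by gcongr; exact min_le_right _ _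
      _ = c := by field_simp
  nlinarith

lemma sum_mul_step {m i : ℕ} (hi : i ≤ m) (f : ℕ → ℝ) :
    ∑ l ∈ Finset.range m, f l * (if i ≤ l then 1 else 0) = walk f m - walk f i := by
  have h := Finset.sum_Ico_eq_sub f hi
  rw [walk, walk, ← h]
  simp only [mul_ite, mul_one, mul_zero, ← Finset.sum_filter]
  refine Finset.sum_congr ?_ fun _ _ => rfl
  ext l
  simp only [Finset.mem_filter, Finset.mem_range, Finset.mem_Ico]
  omega

lemma walk_sub (x v : ℕ → ℝ) (i : ℕ) : walk (fun l => x l - v l) i = walk x i - walk v i :=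
  Finset.sum_sub_distrib _ _

/-- The walk of a best fit agrees with the walk of the data at the end and lies below it. -/
lemma walk_fit_le {m : ℕ} {x v : ℕ → ℝ} (hmono : Monotone v) (hv : isoGain m x = quadGain m x v) :
    walk v m = walk x m ∧ ∀ i ≤ m, walk v i ≤ walk x i := by
  have hstep (i : ℕ) (hi : i ≤ m) :
      walk (fun l => x l - v l) m - walk (fun l => x l - v l) i ≤ 0 := by
    rw [← sum_mul_step hi]
    refine sum_sub_mul_nonpos hv one_pos fun t ht _ a b hab => ?_
    have := hmono hab
    dsimp only
    split_ifs with h1 h2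
    · linarith
    · omega
    · linarith
    · linarith
  -- constant directions are admissible with both signs
  have hneg : -(walk (fun l => x l - v l) m) ≤ 0 := by
    have := sum_sub_mul_nonpos (d := fun _ => -1) hv one_pos fun t ht _ a b hab => by
      have := hmono hab
      dsimp only
      linarith
    simpa [walk] using this
  have h0 := hstep 0 (Nat.zero_le _)
  have hw0 : walk (fun l => x l - v l) 0 = 0 := by simp [walk]
  have hm : walk (fun l => x l - v l) m = 0 := by linarith
  refine ⟨by linarith [walk_sub x v m], fun i hi => ?_⟩
  linarith [hstep i hi, walk_sub x v i]

/-- The walk of a best fit touches the walk of the data where the fit jumps. -/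
lemma walk_fit_eq_of_lt {m : ℕ} {x v : ℕ → ℝ} (hmono : Monotone v)
    (hv : isoGain m x = quadGain m x v) {i : ℕ} (hi : i < m) (hlt : v i < v (i + 1)) :
    walk v (i + 1) = walk x (i + 1) := by
  obtain ⟨hm, hle⟩ := walk_fit_le hmono hv
  refine le_antisymm (hle _ hi) ?_
  have h := sum_sub_mul_nonpos (d := fun l => -(if i + 1 ≤ l then 1 else 0)) hv
    (sub_pos.2 hlt) fun t ht hδ a b hab => by
      have := hmono hab
      dsimp only
      split_ifs with h1 h2 h2
      · linarith
      · omega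
      · have := hmono (show a ≤ i by omega)
        have := hmono h2
        linarith
      · linarith
  have h' := sum_mul_step (m := m) (i := i + 1) hi fun l => x l - v l
  simp only [mul_neg, Finset.sum_neg_distrib] at h
  rw [h', walk_sub, walk_sub] at h
  linarith

/-! ### Faces of the greatest convex minorant -/

/-- The chord of the walk of `x` from `j` to `j + k` lies below the walk on `[0, m]`, strictly
so at the points before `j + k` other than `j`. -/
def IsFace (m j k : ℕ) (x : ℕ → ℝ) : Prop :=
  ∀ i ≤ m, walk x j + (walk x (j + k) - walk x j) / k * ((i : ℝ) - j) ≤ walk x i ∧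
    (i < j + k → i ≠ j →
      walk x j + (walk x (j + k) - walk x j) / k * ((i : ℝ) - j) < walk x i)

/-- The enumeration of the indices outside `[j, j + k)`. -/
def skip (j k l : ℕ) : ℕ := if l < j then l else l + k

lemma skip_mono (j k : ℕ) : Monotone (skip j k) := fun a b hab => by
  unfold skip; split_ifs <;> omega

lemma sum_range_eq_sum_skip_add {m j k : ℕ} (h : j + k ≤ m) (f : ℕ → ℝ) :
    ∑ l ∈ Finset.range m, f l =
      ∑ l ∈ Finset.range (m - k), f (skip j k l) + ∑ l ∈ Finset.range k, f (j + l) := by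
  obtain ⟨t, rfl⟩ := Nat.exists_eq_add_of_le h
  rw [show j + k + t - k = j + t by omega, Finset.sum_range_add, Finset.sum_range_add,
    Finset.sum_range_add _ j t]
  have h1 : ∑ l ∈ Finset.range j, f (skip j k l) = ∑ l ∈ Finset.range j, f l :=
    Finset.sum_congr rfl fun l hl => by simp [skip, Finset.mem_range.1 hl]
  have h2 : ∑ l ∈ Finset.range t, f (skip j k (j + l)) = ∑ l ∈ Finset.range t, f (j + k + l) :=
    Finset.sum_congr rfl fun l _ => by simp [skip]; congr 1; omega
  rw [h1, h2]
  ring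

lemma walk_add (x : ℕ → ℝ) (a b : ℕ) :
    walk x (a + b) = walk x a + ∑ l ∈ Finset.range b, x (a + l) :=
  Finset.sum_range_add _ _ _

/-- In general position every index lies in a face, and removing this face from `x` loses at most
the gain of its mean: the face is the constancy block of the best fit. -/
lemma exists_isFace {m : ℕ} {x : ℕ → ℝ}
    (hgen : ∀ a b c : ℕ, a < b → b < c → c ≤ m →
      ((c : ℝ) - b) * (walk x b - walk x a) ≠ ((b : ℝ) - a) * (walk x c - walk x b))
    {l : ℕ} (hl : l < m) :
    ∃ j k, 1 ≤ k ∧ j ≤ l ∧ l < j + k ∧ j + k ≤ m ∧ IsFace m j k x ∧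
      isoGain m x ≤ isoGain (m - k) (fun i => x (skip j k i))
        + (walk x (j + k) - walk x j) ^ 2 / k := by
  classical
  obtain ⟨v, hmono, hv⟩ := exists_isoGain_eq m x
  obtain ⟨hm, hle⟩ := walk_fit_le hmono hv
  have hjex : ∃ i, v i = v l := ⟨l, rfl⟩
  have heex : ∃ i, l < i ∧ (i = m ∨ v i ≠ v l) := ⟨m, hl, Or.inl rfl⟩
  obtain ⟨j, hj⟩ : ∃ j, j = Nat.find hjex := ⟨_, rfl⟩
  obtain ⟨e, he⟩ : ∃ e, e = Nat.find heex := ⟨_, rfl⟩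
  have hvj : v j = v l := hj ▸ Nat.find_spec hjex
  have hjl : j ≤ l := hj ▸ Nat.find_min' hjex rfl
  have hjmin (i : ℕ) (hi : i < j) : v i < v l :=
    lt_of_le_of_ne (hmono (by omega)) (Nat.find_min hjex (hj ▸ hi))
  have hespec : l < e ∧ (e = m ∨ v e ≠ v l) := he ▸ Nat.find_spec heex
  have hem : e ≤ m := he ▸ Nat.find_min' heex ⟨hl, Or.inl rfl⟩
  have hemin (i : ℕ) (h1 : l ≤ i) (h2 : i < e) : v i = v l := by
    rcases h1.eq_or_lt with rfl | h1
    · rfl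
    have := Nat.find_min heex (he ▸ h2)
    push Not at this
    exact (this h1).2
  have hconst (i : ℕ) (h1 : j ≤ i) (h2 : i < e) : v i = v l := by
    rcases le_total l i with h | h
    · exact hemin i h h2
    · exact le_antisymm (hmono h) (hvj ▸ hmono h1)
  have hDj : walk v j = walk x j := by
    rcases j with _ | j
    · simp [walk]
    · refine walk_fit_eq_of_lt hmono hv (by omega) ?_
      rw [hvj]
      exact hjmin j (by omega)
  have hDe : walk v e = walk x e := by
    rcases hespec.2 with h | h
    · rw [h, hm]
    · obtain ⟨e, rfl⟩ : ∃ e', e = e' + 1 := ⟨e - 1, by omega⟩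
      refine walk_fit_eq_of_lt hmono hv (by omega) ?_
      rw [hemin e (by omega) (by omega)]
      exact lt_of_le_of_ne (hmono (by omega)) (Ne.symm h)
  obtain ⟨k, rfl⟩ := Nat.exists_eq_add_of_le (show j ≤ e by omega)
  have hk : 1 ≤ k := by omega
  have hk0 : (0 : ℝ) < k := by exact_mod_cast hk
  have hblock (t : ℕ) (ht : t ≤ k) : walk v (j + t) = walk v j + t * v l := by
    rw [walk_add, Finset.sum_congr rfl fun i hi => hconst (j + i) (by omega)
      (by have := Finset.mem_range.1 hi; omega)]
    simp
  have hslope : (walk x (j + k) - walk x j) / k = v l := by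
    rw [← hDj, ← hDe, hblock k le_rfl]
    field_simp
    ring
  refine ⟨j, k, hk, hjl, hespec.1, hem, fun i hi => ?_, ?_⟩
  · rw [hslope]
    -- before the block `v` is smaller than on it; this strictness needs no genericity
    have hbefore (hij : i < j) : walk x j + v l * ((i : ℝ) - j) < walk x i := by
      obtain ⟨t, rfl⟩ := Nat.exists_eq_add_of_le hij.le
      have h1 : ∑ r ∈ Finset.range t, v (i + r) < ∑ r ∈ Finset.range t, v l :=
        Finset.sum_lt_sum_of_nonempty (by simp; omega)
          fun r hr => hjmin _ (by have := Finset.mem_range.1 hr; omega)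
      have h2 := walk_add v i t
      have h3 := hle i (by omega)
      simp only [Finset.sum_const, Finset.card_range, nsmul_eq_mul] at h1
      push_cast
      linarith
    -- inside the block equality would make three points of the walk collinear
    have hinside (h1 : j < i) (h2 : i < j + k) : walk x j + v l * ((i : ℝ) - j) < walk x i := by
      obtain ⟨t, rfl⟩ := Nat.exists_eq_add_of_le h1.le
      have h3 := hle _ hi
      rw [hblock t (by omega), hDj] at h3
      refine lt_of_le_of_ne (by push_cast; linarith) fun h => ?_
      refine hgen j (j + t) (j + k) h1 h2 hem ?_
      have h4 := hblock k le_rfl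
      rw [hDe, hDj] at h4
      rw [← h, h4]
      push_cast
      ring
    have hafter (h1 : j + k ≤ i) : walk x j + v l * ((i : ℝ) - j) ≤ walk x i := by
      obtain ⟨t, rfl⟩ := Nat.exists_eq_add_of_le h1
      have h2 : ∑ r ∈ Finset.range t, v l ≤ ∑ r ∈ Finset.range t, v (j + k + r) :=
        Finset.sum_le_sum fun r _ => hmono (by omega)
      have h3 := walk_add v (j + k) t
      have h4 := hle _ hi
      rw [hblock k le_rfl, hDj] at h3
      simp only [Finset.sum_const, Finset.card_range, nsmul_eq_mul] at h2
      push_cast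
      linarith
    refine ⟨?_, fun h1 h2 => ?_⟩
    · rcases lt_trichotomy i j with h | rfl | h
      · exact (hbefore h).le
      · simp
      · rcases lt_or_ge i (j + k) with h' | h'
        · exact (hinside h h').le
        · exact hafter h'
    · rcases h2.lt_or_gt with h | h
      · exact hbefore h
      · exact hinside h h1
  · rw [hv, quadGain, sum_range_eq_sum_skip_add hem]
    refine add_le_add (quadGain_le_isoGain (m - k) (fun i => x (skip j k i))
      (hmono.comp (skip_mono j k))) (le_of_eq ?_)
    rw [Finset.sum_congr rfl fun i hi => by
      rw [hconst (j + i) (by omega) (by have := Finset.mem_range.1 hi; omega)]]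
    have h1 := walk_add x j k
    have h2 : walk x (j + k) - walk x j = k * v l := by
      rw [← hslope]; field_simp
    rw [Finset.sum_sub_distrib, ← Finset.sum_mul, ← Finset.mul_sum]
    rw [show ∑ i ∈ Finset.range k, x (j + i) = k * v l by linarith, h2]
    simp
    field_simp
    ring

/-! ### Inserting a cyclically shifted block -/

/-- The rearrangement of indices for which `w ∘ insertShift m k j r` is obtained from `w` by
taking out the last `k` of the first `m` terms, shifting them cyclically by `r`, and inserting them
at place `j`. -/
def insertShift (m k j r i : ℕ) : ℕ :=
  if i < j then i else if i < j + k then m - k + (i - j + r) % k else if i < m then i - k else i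

lemma injective_insertShift {m k j : ℕ} (hk : 1 ≤ k) (h : j + k ≤ m) (r : ℕ) :
    Function.Injective (insertShift m k j r) := by
  have hmod (a b : ℕ) (ha : a < k) (hb : b < k) (hab : (a + r) % k = (b + r) % k) : a = b :=
    Nat.ModEq.eq_of_lt_of_lt (Nat.ModEq.add_right_cancel' r hab) ha hb
  intro a b hab
  have h1 : (a - j + r) % k < k := Nat.mod_lt _ hk
  have h2 : (b - j + r) % k < k := Nat.mod_lt _ hk
  have h3 := hmod (a - j) (b - j)
  unfold insertShift at hab
  split_ifs at hab <;> omega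

lemma insertShift_skip {m k j r i : ℕ} (hi : i < m - k) :
    insertShift m k j r (skip j k i) = i := by
  unfold insertShift skip
  split_ifs <;> omega

/-- The walk of the `k`-periodic continuation of the last `k` of the first `m` terms of `w`. -/
def cycleWalk (m k : ℕ) (w : ℕ → ℝ) : ℕ → ℝ := walk fun l => w (m - k + l % k)

lemma cycleWalk_add_period (m k : ℕ) (w : ℕ → ℝ) (t : ℕ) :
    cycleWalk m k w (t + k) = cycleWalk m k w t + cycleWalk m k w k := by
  rw [add_comm t k, cycleWalk, walk_add, add_comm]
  simp [walk]

lemma cycleWalk_period {m k : ℕ} (w : ℕ → ℝ) (h : k ≤ m) :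
    cycleWalk m k w k = walk w m - walk w (m - k) := by
  have h1 := walk_add w (m - k) k
  rw [Nat.sub_add_cancel h] at h1
  rw [h1, add_sub_cancel_left, cycleWalk, walk]
  exact Finset.sum_congr rfl fun l hl => by rw [Nat.mod_eq_of_lt (Finset.mem_range.1 hl)]

section walk_insertShift

variable {m k j r : ℕ} (w : ℕ → ℝ)

lemma walk_insertShift_of_le {i : ℕ} (hi : i ≤ j) :
    walk (fun l => w (insertShift m k j r l)) i = walk w i :=
  Finset.sum_congr rfl fun l hl => by
    have := Finset.mem_range.1 hl
    change w (insertShift m k j r l) = w l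
    rw [insertShift, if_pos (by omega)]

lemma walk_insertShift_block {t : ℕ} (ht : t ≤ k) :
    walk (fun l => w (insertShift m k j r l)) (j + t)
      = walk w j + (cycleWalk m k w (r + t) - cycleWalk m k w r) := by
  rw [walk_add, walk_insertShift_of_le w le_rfl, cycleWalk, walk_add, add_sub_cancel_left]
  congr 1
  refine Finset.sum_congr rfl fun l hl => ?_
  have := Finset.mem_range.1 hl
  rw [insertShift, if_neg (by omega), if_pos (by omega), Nat.add_sub_cancel_left, add_comm l r]

lemma walk_insertShift_of_ge {t : ℕ} (ht : j + k + t ≤ m) :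
    walk (fun l => w (insertShift m k j r l)) (j + k + t)
      = walk w (j + t) + cycleWalk m k w k := by
  rw [walk_add, walk_insertShift_block w le_rfl, walk_add w j t, cycleWalk_add_period]
  have : ∑ l ∈ Finset.range t, w (insertShift m k j r (j + k + l))
      = ∑ l ∈ Finset.range t, w (j + l) := Finset.sum_congr rfl fun l hl => by
    have := Finset.mem_range.1 hl
    rw [insertShift, if_neg (by omega), if_neg (by omega), if_pos (by omega)]
    congr 1
    omega
  rw [this]
  ring

end walk_insertShift

/-- The place at which a block is inserted as a face is the first minimiser of the remaining walk
with the slope of the block removed, and the shift is the strict minimiser of the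
periodic continuation of the block. Hence both are unique. -/
lemma isFace_insertShift_unique {m k : ℕ} (hk : 1 ≤ k) {w : ℕ → ℝ} {j j' r r' : ℕ}
    (hj : j + k ≤ m) (hj' : j' + k ≤ m) (hr : r < k) (hr' : r' < k)
    (hF : IsFace m j k fun l => w (insertShift m k j r l))
    (hF' : IsFace m j' k fun l => w (insertShift m k j' r' l)) : j = j' ∧ r = r' := by
  set B := cycleWalk m k w k with hB
  have hk0 : (0 : ℝ) < k := by exact_mod_cast hk
  have hBk : B / k * k = B := by field_simp
  have hperiod := cycleWalk_add_period m k w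
  -- the consequences of the face property for the three parts of the rearranged walk
  have main (j r : ℕ) (hj : j + k ≤ m) (hF : IsFace m j k fun l => w (insertShift m k j r l)) :
      (∀ i < j, walk w j + B / k * ((i : ℝ) - j) < walk w i) ∧
      (∀ t, j + k + t ≤ m → walk w j + B / k * t ≤ walk w (j + t)) ∧
      (∀ t, 0 < t → t < k → cycleWalk m k w r + B / k * t < cycleWalk m k w (r + t)) := by
    have hend := walk_insertShift_block (m := m) (k := k) (j := j) (r := r) w le_rfl
    have hstart := walk_insertShift_of_le (m := m) (k := k) (j := j) (r := r) w le_rfl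
    rw [hperiod, add_sub_cancel_left] at hend
    unfold IsFace at hF
    simp only [hend, hstart, add_sub_cancel_left] at hF
    refine ⟨fun i hi => ?_, fun t ht => ?_, fun t h0 ht => ?_⟩
    · have := (hF i (by omega)).2 (by omega) (by omega)
      rwa [walk_insertShift_of_le w hi.le] at this
    · have := (hF _ ht).1
      rw [walk_insertShift_of_ge w ht] at this
      push_cast at this
      rw [← hB] at *
      linarith
    · have := (hF (j + t) (by omega)).2 (by omega) (by omega)
      rw [walk_insertShift_block w ht.le] at this
      push_cast at this
      linarith
  have hplace (j j' r r' : ℕ) (hj : j + k ≤ m) (hj' : j' + k ≤ m)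
      (hF : IsFace m j k fun l => w (insertShift m k j r l))
      (hF' : IsFace m j' k fun l => w (insertShift m k j' r' l)) : ¬ j < j' := fun hlt => by
    obtain ⟨t, rfl⟩ := Nat.exists_eq_add_of_le hlt.le
    have h1 := (main j r hj hF).2.1 t (by omega)
    have h2 := (main (j + t) r' hj' hF').1 j hlt
    push_cast at h2
    linarith
  have hshift (j j' r r' : ℕ) (hj : j + k ≤ m) (hj' : j' + k ≤ m) (hr' : r' < k)
      (hF : IsFace m j k fun l => w (insertShift m k j r l))
      (hF' : IsFace m j' k fun l => w (insertShift m k j' r' l)) : ¬ r < r' := fun hlt => by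
    obtain ⟨t, rfl⟩ := Nat.exists_eq_add_of_le hlt.le
    have h1 := (main j r hj hF).2.2 t (by omega) (by omega)
    have h2 := (main j' (r + t) hj' hF').2.2 (k - t) (by omega) (by omega)
    rw [show r + t + (k - t) = r + k by omega, hperiod, Nat.cast_sub (by omega)] at h2
    linarith
  have a1 := hplace j j' r r' hj hj' hF hF'
  have a2 := hplace j' j r' r hj' hj hF' hF
  have a3 := hshift j j' r r' hj hj' hr' hF hF'
  have a4 := hshift j' j r' r hj' hj hr hF' hF
  omega

/-! ### Sequences of independent standard Gaussian variables -/

/-- The law of a sequence of independent standard Gaussian variables. -/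
noncomputable def gaussSeq : Measure (ℕ → ℝ) := Measure.infinitePi fun _ => gaussianReal 0 1

instance : IsProbabilityMeasure gaussSeq := by unfold gaussSeq; infer_instance

lemma map_gaussSeq_comp {f : ℕ → ℕ} (hf : Function.Injective f) :
    gaussSeq.map (fun w i => w (f i)) = gaussSeq :=
  Measure.map_infinitePi_infinitePi_of_inj hf

lemma lintegral_gaussSeq_comp {f : ℕ → ℕ} (hf : Function.Injective f) {F : (ℕ → ℝ) → ENNReal}
    (hF : Measurable F) : ∫⁻ w, F (fun i => w (f i)) ∂gaussSeq = ∫⁻ w, F w ∂gaussSeq := by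
  conv_rhs => rw [← map_gaussSeq_comp hf, lintegral_map hF (by fun_prop)]

lemma iIndepFun_gaussSeq : iIndepFun (fun (i : ℕ) (w : ℕ → ℝ) => w i) gaussSeq :=
  iIndepFun_infinitePi (X := fun _ x => x) fun _ => measurable_id

/-- Measurable functions of disjoint sets of coordinates are independent. -/
lemma indepFun_of_dependsOn {α β : Type*} [MeasurableSpace α] [MeasurableSpace β]
    {F : (ℕ → ℝ) → α} {G : (ℕ → ℝ) → β} (hF : Measurable F) (hG : Measurable G)
    {S T : Finset ℕ} (hST : Disjoint S T) (hFS : DependsOn F S) (hGT : DependsOn G T) :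
    IndepFun F G gaussSeq := by
  classical
  have hext (U : Finset ℕ) : Measurable fun (z : U → ℝ) (i : ℕ) =>
      if h : i ∈ U then z ⟨i, h⟩ else 0 := measurable_pi_lambda _ fun i => by
    by_cases h : i ∈ U
    · simp only [h, dite_true]; fun_prop
    · simp only [h, dite_false]; fun_prop
  have h := (iIndepFun_gaussSeq.indepFun_finset S T hST fun i => measurable_pi_apply i).comp
    (hF.comp (hext S)) (hG.comp (hext T))
  convert h using 1
  · funext w
    exact hFS fun i hi => by simp [Finset.mem_coe.1 hi]
  · funext w
    exact hGT fun i hi => by simp [Finset.mem_coe.1 hi]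

@[fun_prop]
lemma measurable_walk (i : ℕ) : Measurable fun x : ℕ → ℝ => walk x i := by
  unfold walk; fun_prop

lemma dependsOn_walk (i : ℕ) : DependsOn (fun x : ℕ → ℝ => walk x i) (Finset.range i) :=
  fun _ _ h => Finset.sum_congr rfl fun l hl => h l (Finset.mem_coe.2 hl)

lemma dependsOn_isoGain (m : ℕ) : DependsOn (isoGain m) (Finset.range m) :=
  fun _ _ h => isoGain_congr fun l hl => h l (Finset.mem_coe.2 (Finset.mem_range.2 hl))

@[fun_prop]
lemma measurable_isoGain (m : ℕ) : Measurable (isoGain m) := by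
  refine LowerSemicontinuous.measurable
    (lowerSemicontinuous_ciSup (bddAbove_quadGain m) fun v => ?_)
  refine Continuous.lowerSemicontinuous ?_
  unfold quadGain
  fun_prop

lemma map_walk_gaussSeq (k : ℕ) : gaussSeq.map (fun w => walk w k) = gaussianReal 0 k := by
  induction k with
  | zero => simp [walk]
  | succ k ih =>
    have hind : IndepFun (fun w : ℕ → ℝ => walk w k) (fun w => w k) gaussSeq :=
      indepFun_of_dependsOn (by fun_prop) (by fun_prop) (S := Finset.range k) (T := {k}) (by simp)
        (dependsOn_walk k) fun _ _ h => h k (by simp)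
    have h := gaussianReal_add_gaussianReal_of_indepFun hind ih
      (Measure.infinitePi_map_eval (fun _ => gaussianReal 0 1) k)
    simp only [add_zero] at h
    rw [Nat.cast_succ, ← h]
    congr 1
    funext w
    simp [walk, Finset.sum_range_succ]

lemma map_walk_sub_gaussSeq (a k : ℕ) :
    gaussSeq.map (fun w => walk w (a + k) - walk w a) = gaussianReal 0 k := by
  rw [← map_walk_gaussSeq k]
  conv_rhs => rw [← map_gaussSeq_comp (add_right_injective a),
    Measure.map_map (by fun_prop) (by fun_prop)]
  congr 1
  funext w
  simp only [Function.comp_apply, walk_add, add_sub_cancel_left]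
  rfl

lemma dependsOn_walk_sub (a k : ℕ) :
    DependsOn (fun x : ℕ → ℝ => walk x (a + k) - walk x a) (Finset.Ico a (a + k)) := by
  intro x y h
  simp only [walk_add, add_sub_cancel_left]
  refine Finset.sum_congr rfl fun l hl => h _ ?_
  have := Finset.mem_range.1 hl
  simp only [Finset.coe_Ico, Set.mem_Ico]
  omega

/-- Almost surely no three points of the graph of the Gaussian random walk are collinear. -/
lemma ae_walk_not_collinear :
    ∀ᵐ x ∂gaussSeq, ∀ a b c : ℕ, a < b → b < c →
      ((c : ℝ) - b) * (walk x b - walk x a) ≠ ((b : ℝ) - a) * (walk x c - walk x b) := by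
  simp only [ae_all_iff]
  intro a b c hab hbc
  obtain ⟨p, rfl⟩ := Nat.exists_eq_add_of_le hab.le
  obtain ⟨q, rfl⟩ := Nat.exists_eq_add_of_le hbc.le
  have hind : IndepFun (fun w : ℕ → ℝ => (q : ℝ) * (walk w (a + p) - walk w a))
      (fun w : ℕ → ℝ => (-p : ℝ) * (walk w (a + p + q) - walk w (a + p))) gaussSeq :=
    IndepFun.comp (φ := fun t => (q : ℝ) * t) (ψ := fun t => (-p : ℝ) * t)
      (indepFun_of_dependsOn (by fun_prop) (by fun_prop) (Finset.Ico_disjoint_Ico_consecutive _ _ _)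
        (dependsOn_walk_sub a p) (dependsOn_walk_sub (a + p) q)) (by fun_prop) (by fun_prop)
  have hlaw (r : ℝ) (d k : ℕ) : gaussSeq.map (fun w => r * (walk w (d + k) - walk w d))
      = gaussianReal (r * 0) (.mk (r ^ 2) (sq_nonneg r) * k) := by
    rw [← gaussianReal_map_const_mul, ← map_walk_sub_gaussSeq d k,
      Measure.map_map (by fun_prop) (by fun_prop)]
    rfl
  have h := gaussianReal_add_gaussianReal_of_indepFun hind (hlaw _ _ _) (hlaw _ _ _)
  have hq : (q : ℝ) ≠ 0 := by norm_cast; omega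
  have := nullSingletonClass_gaussianReal (μ := (q : ℝ) * 0 + (-p : ℝ) * 0)
    (v := .mk ((q : ℝ) ^ 2) (sq_nonneg _) * p + .mk ((-p : ℝ) ^ 2) (sq_nonneg _) * q) (fun h => by
      have h1 := congrArg NNReal.toReal h
      simp only [NNReal.coe_add, NNReal.coe_mul, NNReal.coe_mk, NNReal.coe_natCast, neg_sq,
        NNReal.coe_zero] at h1
      have hp : (0 : ℝ) < p := by norm_cast; omega
      have hq : (0 : ℝ) < q := by norm_cast; omega
      have : 0 < (q : ℝ) ^ 2 * p + (p : ℝ) ^ 2 * q := by positivity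
      linarith)
  have h0 := this.measure_singleton 0
  rw [← h, Measure.map_apply (by fun_prop) (measurableSet_singleton 0)] at h0
  filter_upwards [measure_eq_zero_iff_ae_notMem.1 h0] with x hx heq
  apply hx
  simp only [Set.mem_preimage, Pi.add_apply, Set.mem_singleton_iff]
  push_cast at heq
  linarith

/-! ### Exponential moments of the gain -/

lemma lintegral_exp_mul_sq_gaussianReal {t : ℝ} (ht : t < 1 / 2) :
    ∫⁻ x, ENNReal.ofReal (Real.exp (t * x ^ 2)) ∂gaussianReal 0 1
      = ENNReal.ofReal (√(1 - 2 * t))⁻¹ := by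
  have hb : 0 < 1 / 2 - t := by linarith
  rw [gaussianReal_of_var_ne_zero 0 one_ne_zero,
    lintegral_withDensity_eq_lintegral_mul _ (measurable_gaussianPDF 0 1) (by fun_prop)]
  have h1 (x : ℝ) : (gaussianPDF 0 1 * fun x => ENNReal.ofReal (Real.exp (t * x ^ 2))) x
      = ENNReal.ofReal ((√(2 * Real.pi))⁻¹ * Real.exp (-(1 / 2 - t) * x ^ 2)) := by
    rw [Pi.mul_apply, gaussianPDF, ← ENNReal.ofReal_mul (gaussianPDFReal_nonneg _ _ _),
      gaussianPDFReal, mul_assoc, ← Real.exp_add]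
    congr 3
    · simp
    · simp; ring
  simp_rw [h1]
  rw [← ofReal_integral_eq_lintegral_ofReal ((integrable_exp_neg_mul_sq hb).const_mul _)
    (Filter.Eventually.of_forall fun x => by positivity), integral_const_mul, integral_gaussian]
  congr 1
  rw [← Real.sqrt_inv, ← Real.sqrt_inv, ← Real.sqrt_mul (by positivity)]
  congr 1
  have := Real.pi_pos
  rw [show 1 - 2 * t = 2 * (1 / 2 - t) by ring]
  field_simp

lemma lintegral_exp_walk_sub {t : ℝ} (ht : t < 1 / 2) (a : ℕ) {k : ℕ} (hk : 1 ≤ k) :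
    ∫⁻ w, ENNReal.ofReal (Real.exp (t * ((walk w (a + k) - walk w a) ^ 2 / k))) ∂gaussSeq
      = ENNReal.ofReal (√(1 - 2 * t))⁻¹ := by
  have hk0 : (0 : ℝ) < k := by exact_mod_cast hk
  have h1 : gaussianReal 0 (k : NNReal) = (gaussianReal 0 1).map (√(k : ℝ) * ·) := by
    rw [gaussianReal_map_const_mul]
    congr 1
    · simp
    · ext; simp
  rw [← lintegral_exp_mul_sq_gaussianReal ht,
    ← lintegral_map (f := fun x : ℝ => ENNReal.ofReal (Real.exp (t * (x ^ 2 / k))))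
      (g := fun w => walk w (a + k) - walk w a) (by fun_prop) (by fun_prop),
    map_walk_sub_gaussSeq, h1, lintegral_map (by fun_prop) (by fun_prop)]
  refine lintegral_congr fun x => ?_
  rw [mul_pow, Real.sq_sqrt hk0.le]
  field_simp

/-- The exponential moment of order `t` of the gain for `m` standard Gaussian observations. -/
noncomputable def expGain (t : ℝ) (m : ℕ) : ENNReal :=
  ∫⁻ w, ENNReal.ofReal (Real.exp (t * isoGain m w)) ∂gaussSeq

lemma measurableSet_isFace (m j k : ℕ) : MeasurableSet {x | IsFace m j k x} := by
  unfold IsFace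
  simp only [Set.ofPred_forall, Set.ofPred_and]
  refine .iInter fun i => .iInter fun _ => .inter ?_ (.iInter fun _ => .iInter fun _ => ?_)
  · exact measurableSet_le (by fun_prop) (by fun_prop)
  · exact measurableSet_lt (by fun_prop) (by fun_prop)

/-- On the event that `[j, j + k)` is a face of the first `m` terms of `x`, the exponential of the
gain of `x` without this face plus the gain of the mean of the face; zero elsewhere. -/
noncomputable def faceTerm (t : ℝ) (m k j : ℕ) (x : ℕ → ℝ) : ENNReal :=
  {x | IsFace m j k x}.indicator (fun x => ENNReal.ofReal (Real.exp (t *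
    (isoGain (m - k) (fun i => x (skip j k i)) + (walk x (j + k) - walk x j) ^ 2 / k)))) x

lemma measurable_faceTerm (t : ℝ) (m k j : ℕ) : Measurable (faceTerm t m k j) := by
  refine Measurable.indicator ?_ (measurableSet_isFace m j k)
  have : Measurable fun x : ℕ → ℝ => isoGain (m - k) (fun i => x (skip j k i)) :=
    (measurable_isoGain _).comp (by fun_prop)
  fun_prop

/-- Each of the `m` indices lies in a face, and a face of length `k` contains `k` indices. -/
lemma mul_exp_isoGain_le_sum_faceTerm {t : ℝ} (ht : 0 ≤ t) {m : ℕ} {x : ℕ → ℝ}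
    (hgen : ∀ a b c : ℕ, a < b → b < c →
      ((c : ℝ) - b) * (walk x b - walk x a) ≠ ((b : ℝ) - a) * (walk x c - walk x b)) :
    (m : ENNReal) * ENNReal.ofReal (Real.exp (t * isoGain m x))
      ≤ ∑ k ∈ Finset.Icc 1 m, ∑ j ∈ Finset.range (m - k + 1), k * faceTerm t m k j x := by
  have hone (l : ℕ) (hl : l < m) : ENNReal.ofReal (Real.exp (t * isoGain m x))
      ≤ ∑ k ∈ Finset.Icc 1 m, ∑ j ∈ Finset.range (m - k + 1),
        if l ∈ Finset.Ico j (j + k) then faceTerm t m k j x else 0 := by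
    obtain ⟨j, k, hk, hjl, hlk, hm, hF, hle⟩ :=
      exists_isFace (m := m) (fun a b c h1 h2 _ => hgen a b c h1 h2) hl
    refine le_trans ?_ (Finset.single_le_sum (fun _ _ => zero_le)
      (Finset.mem_Icc.2 ⟨hk, show k ≤ m by omega⟩))
    refine le_trans ?_ (Finset.single_le_sum (fun _ _ => zero_le)
      (Finset.mem_range.2 (show j < m - k + 1 by omega)))
    rw [if_pos (Finset.mem_Ico.2 ⟨hjl, hlk⟩), faceTerm, Set.indicator_of_mem (by exact hF)]
    gcongr
  calc (m : ENNReal) * ENNReal.ofReal (Real.exp (t * isoGain m x))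
      = ∑ l ∈ Finset.range m, ENNReal.ofReal (Real.exp (t * isoGain m x)) := by simp
    _ ≤ ∑ l ∈ Finset.range m, ∑ k ∈ Finset.Icc 1 m, ∑ j ∈ Finset.range (m - k + 1),
        if l ∈ Finset.Ico j (j + k) then faceTerm t m k j x else 0 :=
      Finset.sum_le_sum fun l hl => hone l (Finset.mem_range.1 hl)
    _ = ∑ k ∈ Finset.Icc 1 m, ∑ j ∈ Finset.range (m - k + 1), ∑ l ∈ Finset.range m,
        if l ∈ Finset.Ico j (j + k) then faceTerm t m k j x else 0 := by
      rw [Finset.sum_comm]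
      exact Finset.sum_congr rfl fun k _ => Finset.sum_comm
    _ ≤ _ := by
      refine Finset.sum_le_sum fun k _ => Finset.sum_le_sum fun j _ => ?_
      rw [← Finset.sum_filter, Finset.sum_const, nsmul_eq_mul]
      gcongr
      calc _ ≤ (Finset.Ico j (j + k)).card := Finset.card_le_card fun l hl =>
            (Finset.mem_filter.1 hl).2
        _ = k := by simp

/-- Among all rearrangements of a sequence that insert a given block, shifted cyclically, at
some place, at most one turns the block into a face. -/
lemma sum_faceTerm_insertShift_le (t : ℝ) {m k : ℕ} (hk : 1 ≤ k) (hkm : k ≤ m) (w : ℕ → ℝ) :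
    ∑ j ∈ Finset.range (m - k + 1), ∑ r ∈ Finset.range k,
        faceTerm t m k j (fun i => w (insertShift m k j r i))
      ≤ ENNReal.ofReal (Real.exp (t * isoGain (m - k) w))
        * ENNReal.ofReal (Real.exp (t * ((walk w (m - k + k) - walk w (m - k)) ^ 2 / k))) := by
  classical
  set G := ENNReal.ofReal (Real.exp (t * isoGain (m - k) w))
        * ENNReal.ofReal (Real.exp (t * ((walk w (m - k + k) - walk w (m - k)) ^ 2 / k)))
  have hterm (j r : ℕ) : j ∈ Finset.range (m - k + 1) →
      faceTerm t m k j (fun i => w (insertShift m k j r i))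
      = if IsFace m j k (fun i => w (insertShift m k j r i)) then G else 0 := fun hj => by
    have hj := Finset.mem_range.1 hj
    rw [faceTerm, Set.indicator_apply]
    refine if_congr Iff.rfl ?_ rfl
    rw [walk_insertShift_block w le_rfl, walk_insertShift_of_le w le_rfl, cycleWalk_add_period,
      cycleWalk_period w hkm, add_sub_cancel_left, add_sub_cancel_left,
      isoGain_congr (x' := w) fun l hl => congrArg w (insertShift_skip hl), mul_add, Real.exp_add,
      ENNReal.ofReal_mul (Real.exp_nonneg _)]
    simp only [G, Nat.sub_add_cancel hkm]
  rw [← Finset.sum_product' (f := fun j r => faceTerm t m k j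
    (fun i => w (insertShift m k j r i)))]
  rw [Finset.sum_congr rfl fun p hp => hterm p.1 p.2 (Finset.mem_product.1 hp).1,
    ← Finset.sum_filter, Finset.sum_const]
  have hcard : (Finset.filter (fun p : ℕ × ℕ => IsFace m p.1 k
      fun i => w (insertShift m k p.1 p.2 i))
      (Finset.range (m - k + 1) ×ˢ Finset.range k)).card ≤ 1 := by
    refine Finset.card_le_one.2 fun p hp q hq => ?_
    simp only [Finset.mem_filter, Finset.mem_product, Finset.mem_range] at hp hq
    exact Prod.ext_iff.2
      (isFace_insertShift_unique hk (by omega) (by omega) hp.1.2 hq.1.2 hp.2 hq.2)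
  calc _ ≤ 1 • G := by gcongr
    _ = G := one_smul _ _

/-- The recursive inequality satisfied by the exponential moments: a face of length `k` can be
replaced by an independent block of length `k` followed by a shorter sequence. -/
lemma mul_expGain_le {t : ℝ} (ht : 0 ≤ t) (ht2 : t < 1 / 2) (m : ℕ) :
    (m : ENNReal) * expGain t m
      ≤ ENNReal.ofReal (√(1 - 2 * t))⁻¹ * ∑ i ∈ Finset.range m, expGain t i := by
  have hmeas (i : ℕ) : Measurable fun w => ENNReal.ofReal (Real.exp (t * isoGain i w)) := by
    fun_prop
  have hblock (k : ℕ) (hk : k ∈ Finset.Icc 1 m) :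
      ∑ j ∈ Finset.range (m - k + 1), k * ∫⁻ x, faceTerm t m k j x ∂gaussSeq
        ≤ ENNReal.ofReal (√(1 - 2 * t))⁻¹ * expGain t (m - k) := by
    obtain ⟨hk1, hkm⟩ := Finset.mem_Icc.1 hk
    have hj (j : ℕ) (hj : j ∈ Finset.range (m - k + 1)) :
        k * ∫⁻ x, faceTerm t m k j x ∂gaussSeq = ∑ r ∈ Finset.range k,
          ∫⁻ w, faceTerm t m k j (fun i => w (insertShift m k j r i)) ∂gaussSeq := by
      have := Finset.mem_range.1 hj
      rw [Finset.sum_congr rfl fun r _ => lintegral_gaussSeq_comp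
        (injective_insertShift hk1 (by omega) r) (measurable_faceTerm t m k j)]
      simp
    have hcomp (j r : ℕ) : Measurable fun w : ℕ → ℝ =>
        faceTerm t m k j (fun i => w (insertShift m k j r i)) :=
      (measurable_faceTerm t m k j).comp (by fun_prop)
    rw [Finset.sum_congr rfl hj]
    have hswap : ∑ j ∈ Finset.range (m - k + 1), ∑ r ∈ Finset.range k,
          ∫⁻ w, faceTerm t m k j (fun i => w (insertShift m k j r i)) ∂gaussSeq
        = ∫⁻ w, ∑ j ∈ Finset.range (m - k + 1), ∑ r ∈ Finset.range k,
          faceTerm t m k j (fun i => w (insertShift m k j r i)) ∂gaussSeq := by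
      rw [lintegral_finsetSum _ fun j _ => Finset.measurable_fun_sum _ fun r _ => hcomp j r]
      exact Finset.sum_congr rfl fun j _ => (lintegral_finsetSum _ fun r _ => hcomp j r).symm
    rw [hswap]
    refine (lintegral_mono fun w => sum_faceTerm_insertShift_le t hk1 hkm w).trans ?_
    have hind : IndepFun (fun w => ENNReal.ofReal (Real.exp (t * isoGain (m - k) w)))
        (fun w => ENNReal.ofReal (Real.exp
          (t * ((walk w (m - k + k) - walk w (m - k)) ^ 2 / k)))) gaussSeq :=
      IndepFun.comp (φ := fun y => ENNReal.ofReal (Real.exp (t * y)))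
        (ψ := fun y => ENNReal.ofReal (Real.exp (t * (y ^ 2 / k))))
        (indepFun_of_dependsOn (by fun_prop) (by fun_prop)
          (by rw [Finset.range_eq_Ico]; exact Finset.Ico_disjoint_Ico_consecutive _ _ _)
          (dependsOn_isoGain (m - k)) (dependsOn_walk_sub (m - k) k)) (by fun_prop) (by fun_prop)
    rw [lintegral_mul_eq_lintegral_mul_lintegral_of_indepFun'' (by fun_prop) (by fun_prop) hind,
      lintegral_exp_walk_sub ht2 _ hk1, mul_comm, expGain]
  calc (m : ENNReal) * expGain t m
      = ∫⁻ x, m * ENNReal.ofReal (Real.exp (t * isoGain m x)) ∂gaussSeq :=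
        (lintegral_const_mul _ (hmeas m)).symm
    _ ≤ ∫⁻ x, ∑ k ∈ Finset.Icc 1 m, ∑ j ∈ Finset.range (m - k + 1), k * faceTerm t m k j x
        ∂gaussSeq := by
      refine lintegral_mono_ae ?_
      filter_upwards [ae_walk_not_collinear] with x hx
      exact mul_exp_isoGain_le_sum_faceTerm ht hx
    _ = ∑ k ∈ Finset.Icc 1 m, ∑ j ∈ Finset.range (m - k + 1),
        k * ∫⁻ x, faceTerm t m k j x ∂gaussSeq := by
      have hm2 (k j : ℕ) : Measurable fun x => (k : ENNReal) * faceTerm t m k j x :=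
        (measurable_faceTerm t m k j).const_mul _
      rw [lintegral_finsetSum _ fun k _ => Finset.measurable_fun_sum _ fun j _ => hm2 k j]
      refine Finset.sum_congr rfl fun k _ => ?_
      rw [lintegral_finsetSum _ fun j _ => hm2 k j]
      exact Finset.sum_congr rfl fun j _ => lintegral_const_mul _ (measurable_faceTerm t m k j)
    _ ≤ ∑ k ∈ Finset.Icc 1 m, ENNReal.ofReal (√(1 - 2 * t))⁻¹ * expGain t (m - k) :=
      Finset.sum_le_sum hblock
    _ = _ := by
      rw [← Finset.mul_sum]
      congr 1
      refine Finset.sum_nbij' (fun k => m - k) (fun i => m - i) ?_ ?_ ?_ ?_ fun _ _ => rfl <;>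
        intro i hi <;> simp only [Finset.mem_Icc, Finset.mem_range] at hi ⊢ <;> omega

/-- The product of `1 + (s - 1) / i` over `1 ≤ i ≤ m`. It is the mean of `s ^ C` for the number `C`
of cycles of a uniformly random permutation of `m` elements. -/
noncomputable def risingRatio (s : ℝ) (m : ℕ) : ℝ :=
  ∏ i ∈ Finset.range m, ((i + s) / (i + 1))

lemma sum_risingRatio (s : ℝ) (m : ℕ) :
    s * ∑ i ∈ Finset.range m, risingRatio s i = m * risingRatio s m := by
  induction m with
  | zero => simp
  | succ m ih =>
    rw [Finset.sum_range_succ, mul_add, ih]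
    simp only [risingRatio, Finset.prod_range_succ]
    push_cast
    field_simp

lemma risingRatio_nonneg {s : ℝ} (hs : 0 ≤ s) (m : ℕ) : 0 ≤ risingRatio s m :=
  Finset.prod_nonneg fun _ _ => by positivity

lemma risingRatio_le_exp {s : ℝ} (hs : 1 ≤ s) (m : ℕ) :
    risingRatio s m ≤ Real.exp ((s - 1) * (1 + Real.log m)) := by
  have h1 : risingRatio s m ≤ Real.exp ((s - 1) * harmonic m) := by
    rw [harmonic, Rat.cast_sum, Finset.mul_sum, Real.exp_sum]
    refine Finset.prod_le_prod (fun i _ => by positivity) fun i _ => ?_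
    refine le_trans (le_of_eq ?_) (Real.add_one_le_exp _)
    push_cast
    field_simp
    ring
  refine h1.trans (Real.exp_le_exp.2 ?_)
  exact mul_le_mul_of_nonneg_left (harmonic_le_one_add_log m) (by linarith)

lemma expGain_le {t : ℝ} (ht : 0 ≤ t) (ht2 : t < 1 / 2) (m : ℕ) :
    expGain t m ≤ ENNReal.ofReal (risingRatio (√(1 - 2 * t))⁻¹ m) := by
  have hs : 0 ≤ (√(1 - 2 * t))⁻¹ := by positivity
  induction m using Nat.strong_induction_on with
  | _ m ih =>
    rcases Nat.eq_zero_or_pos m with rfl | hm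
    · simp [expGain, isoGain_zero, risingRatio]
    have h1 := (mul_expGain_le ht ht2 m).trans (mul_le_mul_right
      (Finset.sum_le_sum fun i hi => ih i (Finset.mem_range.1 hi)) _)
    rw [← ENNReal.ofReal_sum_of_nonneg fun i _ => risingRatio_nonneg hs i,
      ← ENNReal.ofReal_mul hs, sum_risingRatio, ENNReal.ofReal_mul (Nat.cast_nonneg _),
      ENNReal.ofReal_natCast] at h1
    exact (ENNReal.mul_le_mul_iff_right (by simpa using hm.ne') (ENNReal.natCast_ne_top m)).1 h1

lemma expGain_le_exp {t : ℝ} (ht : 0 ≤ t) (ht2 : t < 1 / 2) (m : ℕ) :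
    expGain t m ≤ ENNReal.ofReal (Real.exp (((√(1 - 2 * t))⁻¹ - 1) * (1 + Real.log m))) := by
  refine (expGain_le ht ht2 m).trans (ENNReal.ofReal_le_ofReal (risingRatio_le_exp ?_ m))
  refine (one_le_inv₀ (by rw [Real.sqrt_pos]; linarith)).2 ?_
  exact Real.sqrt_le_one.2 (by linarith)

/-! ### Sums of gains over disjoint blocks of indices -/

/-- A strictly increasing sequence whose first `b.card` terms list `b`; the later terms only
serve to make it injective. -/
def listing (b : Finset ℕ) (i : ℕ) : ℕ :=
  if h : i < b.card then b.orderEmbOfFin rfl ⟨i, h⟩ else b.sup id + 1 + i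

lemma listing_mem {b : Finset ℕ} {i : ℕ} (hi : i < b.card) : listing b i ∈ b := by
  rw [listing, dif_pos hi]
  exact b.orderEmbOfFin_mem rfl _

lemma strictMono_listing (b : Finset ℕ) : StrictMono (listing b) := by
  intro i j hij
  by_cases hj : j < b.card
  · rw [listing, listing, dif_pos hj, dif_pos (hij.trans hj)]
    exact (b.orderEmbOfFin rfl).strictMono hij
  · by_cases hi : i < b.card
    · have : listing b i ≤ b.sup id := Finset.le_sup (f := id) (listing_mem hi)
      rw [show listing b j = b.sup id + 1 + j by rw [listing, dif_neg hj]]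
      omega
    · rw [listing, listing, dif_neg hj, dif_neg hi]
      omega

lemma sum_listing (b : Finset ℕ) (f : ℕ → ℝ) :
    ∑ i ∈ Finset.range b.card, f (listing b i) = ∑ l ∈ b, f l := by
  have h (i : Fin b.card) : listing b i = b.orderEmbOfFin rfl i := by simp [listing]
  conv_rhs => rw [← Finset.image_orderEmbOfFin_univ b rfl,
    Finset.sum_image fun _ _ _ _ h => (b.orderEmbOfFin rfl).injective h]
  simp only [Finset.sum_range, h]

/-- The largest gain of a fit to `w` that is monotone on the block `b` of indices. -/
noncomputable def blockGain (b : Finset ℕ) (w : ℕ → ℝ) : ℝ :=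
  isoGain b.card fun i => w (listing b i)

@[fun_prop]
lemma measurable_blockGain (b : Finset ℕ) : Measurable (blockGain b) :=
  (measurable_isoGain b.card).comp (by fun_prop)

lemma dependsOn_blockGain (b : Finset ℕ) : DependsOn (blockGain b) b :=
  fun _ _ h => isoGain_congr fun _ hl => h _ (listing_mem hl)

/-- The gains over disjoint blocks are independent, so their exponential moments multiply. -/
lemma lintegral_exp_sum_blockGain {ι : Type*} [DecidableEq ι] (t : ℝ) (b : ι → Finset ℕ)
    (C : Finset ι) (hb : (C : Set ι).PairwiseDisjoint b) :
    ∫⁻ w, ENNReal.ofReal (Real.exp (t * ∑ c ∈ C, blockGain (b c) w)) ∂gaussSeq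
      = ∏ c ∈ C, expGain t (b c).card := by
  induction C using Finset.induction_on with
  | empty => simp
  | insert c C hc ih =>
    have hind : IndepFun (fun w => ENNReal.ofReal (Real.exp (t * blockGain (b c) w)))
        (fun w => ENNReal.ofReal (Real.exp (t * ∑ c ∈ C, blockGain (b c) w))) gaussSeq := by
      refine indepFun_of_dependsOn (by fun_prop) (by fun_prop) (S := b c) (T := C.biUnion b) ?_
        (fun x y h => by simp only [dependsOn_blockGain (b c) h]) (fun x y h => ?_)
      · rw [Finset.disjoint_biUnion_right]
        exact fun d hd => hb (by simp) (by simp [hd]) fun h => hc (h ▸ hd)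
      · rw [Finset.sum_congr rfl fun d hd => dependsOn_blockGain (b d) fun i hi =>
          h i (Finset.mem_coe.2 (Finset.mem_biUnion.2 ⟨d, hd, hi⟩))]
    have hone : ∫⁻ w, ENNReal.ofReal (Real.exp (t * blockGain (b c) w)) ∂gaussSeq
        = expGain t (b c).card :=
      lintegral_gaussSeq_comp (strictMono_listing (b c)).injective
        (F := fun w => ENNReal.ofReal (Real.exp (t * isoGain (b c).card w))) (by fun_prop)
    rw [Finset.prod_insert hc, ← ih (hb.subset (by simp)), ← hone,
      ← lintegral_mul_eq_lintegral_mul_lintegral_of_indepFun'' (by fun_prop) (by fun_prop) hind]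
    refine lintegral_congr fun w => ?_
    rw [Finset.sum_insert hc, mul_add, Real.exp_add, ENNReal.ofReal_mul (Real.exp_nonneg _)]

lemma quadGain_le_isoGain_of_monotoneOn {m : ℕ} (x : ℕ → ℝ) {g : ℕ → ℝ}
    (hg : ∀ a b, a ≤ b → b < m → g a ≤ g b) : quadGain m x g ≤ isoGain m x := by
  rcases Nat.eq_zero_or_pos m with rfl | hm
  · simp [quadGain, isoGain_zero]
  have hmono : Monotone fun i => g (min i (m - 1)) := fun a b hab =>
    hg _ _ (min_le_min_right _ hab) (by omega)
  refine le_trans (le_of_eq ?_) (quadGain_le_isoGain m x hmono)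
  exact quadGain_congr (fun _ _ => rfl) fun l hl => by rw [min_eq_left (by omega)]

/-! ### The pieces of a monotone vector -/

section pieces

variable {n : ℕ}

/-- The indices at which `u` takes the value `c`. -/
noncomputable def level (u : EuclideanSpace ℝ (Fin n)) (c : ℝ) : Finset ℕ :=
  (Finset.univ.filter fun i => u i = c).map Fin.valEmbedding

/-- The largest gain of a fit to `w` that is monotone on each level set of `u`. For nondecreasing `u`
it is the squared norm of the projection of the first `n` terms of `w` onto the tangent cone of
the nondecreasing vectors at `u`. -/
noncomputable def pieceGain (u : EuclideanSpace ℝ (Fin n)) (w : ℕ → ℝ) : ℝ :=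
  ∑ c ∈ Finset.univ.image u, blockGain (level u c) w

lemma pairwiseDisjoint_level (u : EuclideanSpace ℝ (Fin n)) (C : Set ℝ) :
    C.PairwiseDisjoint (level u) := by
  intro c _ d _ hcd
  refine Finset.disjoint_left.2 fun l hl hl' => hcd ?_
  simp only [level, Finset.mem_map, Finset.mem_filter, Finset.mem_univ, true_and] at hl hl'
  obtain ⟨i, rfl, rfl⟩ := hl
  obtain ⟨j, rfl, hj⟩ := hl'
  rw [Fin.valEmbedding.injective hj]

lemma sum_sum_level (u : EuclideanSpace ℝ (Fin n)) (f : ℕ → ℝ) :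
    ∑ c ∈ Finset.univ.image u, ∑ l ∈ level u c, f l = ∑ i : Fin n, f i := by
  simp only [level, Finset.sum_map]
  exact Finset.sum_fiberwise_of_maps_to (g := u)
    (fun i _ => Finset.mem_image_of_mem _ (Finset.mem_univ i)) fun i : Fin n => f i

lemma pieceGain_nonneg (u : EuclideanSpace ℝ (Fin n)) (w : ℕ → ℝ) : 0 ≤ pieceGain u w :=
  Finset.sum_nonneg fun _ _ => isoGain_nonneg _ _

@[fun_prop]
lemma measurable_pieceGain (u : EuclideanSpace ℝ (Fin n)) : Measurable (pieceGain u) := by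
  unfold pieceGain; fun_prop

lemma sum_le_pieceGain (u : EuclideanSpace ℝ (Fin n)) (w : ℕ → ℝ) (h : Fin n → ℝ)
    (hmono : ∀ i j, i ≤ j → u i = u j → h i ≤ h j) :
    ∑ i : Fin n, (2 * w i * h i - h i ^ 2) ≤ pieceGain u w := by
  let h' : ℕ → ℝ := fun l => if hl : l < n then h ⟨l, hl⟩ else 0
  have hh (i : Fin n) : h' i = h i := by simp [h']
  simp only [← hh]
  rw [← sum_sum_level u fun l => 2 * w l * h' l - h' l ^ 2]
  refine Finset.sum_le_sum fun c _ => ?_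
  rw [← sum_listing]
  refine quadGain_le_isoGain_of_monotoneOn (fun i => w (listing (level u c) i))
    (g := fun i => h' (listing (level u c) i)) fun a b hab hb => ?_
  have ha := listing_mem (hab.trans_lt hb)
  have hb := listing_mem hb
  have hle := (strictMono_listing (level u c)).monotone hab
  simp only [level, Finset.mem_map, Finset.mem_filter, Finset.mem_univ, true_and] at ha hb
  obtain ⟨i, hi, hia⟩ := ha
  obtain ⟨j, hj, hjb⟩ := hb
  simp only [level] at hle ⊢
  rw [← hia, ← hjb] at hle ⊢
  simp only [Fin.valEmbedding_apply, hh] at hle ⊢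
  exact hmono i j hle (hi.trans hj.symm)

lemma monotone_of_mem_nondecreasingSeq {u : EuclideanSpace ℝ (Fin n)}
    (hu : u ∈ nondecreasingSeq n) {i j : Fin n} (hij : i ≤ j) : u i ≤ u j := by
  obtain ⟨i, hi⟩ := i
  obtain ⟨j, hj⟩ := j
  obtain ⟨t, rfl⟩ := Nat.exists_eq_add_of_le (show i ≤ j from hij)
  induction t with
  | zero => rfl
  | succ t ih => exact (ih (by omega) (by simp)).trans (hu _ _ rfl)

/-- The pieces of a monotone vector correspond to its values. -/
lemma card_image_eq_numPieces (hn : 0 < n) {u : EuclideanSpace ℝ (Fin n)}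
    (hu : u ∈ nondecreasingSeq n) : (Finset.univ.image u).card = numPieces u := by
  classical
  -- the jumps; together with the last index they list every value exactly once
  let J : Finset (Fin n) :=
    Finset.univ.filter fun i => ∃ j : Fin n, (j : ℕ) = (i : ℕ) + 1 ∧ u i < u j
  have hJ : numPieces u = J.card + 1 := by
    rw [numPieces, ← Set.ncard_coe_finset]
    simp [J]
  let last : Fin n := ⟨n - 1, by omega⟩
  have hlt {i k : Fin n} (hi : i ∈ J) (hik : i < k) : u i < u k := by
    obtain ⟨j, hj, hij⟩ := (Finset.mem_filter.1 hi).2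
    exact hij.trans_le (monotone_of_mem_nondecreasingSeq hu (by
      rw [Fin.le_def, hj]; exact hik))
  have hJlast {i : Fin n} (hi : i ∈ J) : i < last := by
    obtain ⟨j, hj, -⟩ := (Finset.mem_filter.1 hi).2
    rw [Fin.lt_def]
    have := j.2
    simp only [last]
    omega
  have himage : Finset.univ.image u = insert (u last) (J.image u) := by
    refine Finset.Subset.antisymm (fun c hc => ?_) fun c hc => ?_
    · obtain ⟨i, -, rfl⟩ := Finset.mem_image.1 hc
      obtain ⟨k, hk, hkmax⟩ := (Finset.univ.filter fun k => u k = u i).exists_max_image id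
        ⟨i, by simp⟩
      have hk : u k = u i := by simpa using hk
      by_cases hkl : k = last
      · rw [← hk, hkl]; simp
      · have hk1 : (k : ℕ) + 1 < n := by
          have : (k : ℕ) ≠ n - 1 := fun h => hkl (Fin.ext h)
          omega
        refine Finset.mem_insert_of_mem (Finset.mem_image.2 ⟨k, ?_, hk⟩)
        refine Finset.mem_filter.2 ⟨Finset.mem_univ _, ⟨k + 1, hk1⟩, rfl, ?_⟩
        refine lt_of_le_of_ne (hu _ _ rfl) fun h => ?_
        have := hkmax ⟨k + 1, hk1⟩ (by simp [← h, hk])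
        simp [Fin.le_def] at this
    · rcases Finset.mem_insert.1 hc with rfl | hc
      · simp
      · obtain ⟨i, -, rfl⟩ := Finset.mem_image.1 hc
        simp
  rw [hJ, himage, Finset.card_insert_of_notMem, Finset.card_image_of_injOn]
  · intro i hi k hk h
    rcases lt_trichotomy i k with hik | hik | hik
    · exact absurd h (hlt hi hik).ne
    · exact hik
    · exact absurd h (hlt hk hik).ne'
  · intro h
    obtain ⟨i, hi, h⟩ := Finset.mem_image.1 h
    exact (hlt hi (hJlast hi)).ne h

lemma numPieces_le (hn : 0 < n) {u : EuclideanSpace ℝ (Fin n)} (hu : u ∈ nondecreasingSeq n) :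
    numPieces u ≤ n := by
  rw [← card_image_eq_numPieces hn hu]
  simpa using Finset.card_image_le (s := Finset.univ) (f := u)

lemma log_exp_one_mul_div {k : ℕ} (hn : 0 < n) (hk : 0 < k) :
    Real.log (Real.exp 1 * n / k) = 1 + Real.log n - Real.log k := by
  have h1 : (n : ℝ) ≠ 0 := by norm_cast; omega
  have h2 : (k : ℝ) ≠ 0 := by norm_cast; omega
  rw [Real.log_div (by positivity) h2, Real.log_mul (by positivity) h1, Real.log_exp]

lemma mul_log_mono {k l : ℕ} (hk : 0 < k) (hkl : k ≤ l) (hl : l ≤ n) :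
    (k : ℝ) * Real.log (Real.exp 1 * n / k) ≤ l * Real.log (Real.exp 1 * n / l) := by
  have hk0 : (0 : ℝ) < k := by exact_mod_cast hk
  have hl0 : (0 : ℝ) < l := by exact_mod_cast hk.trans_le hkl
  have hkl' : (k : ℝ) ≤ l := by exact_mod_cast hkl
  have hln : Real.log l ≤ Real.log n := Real.log_le_log hl0 (by exact_mod_cast hl)
  rw [log_exp_one_mul_div (by omega) hk, log_exp_one_mul_div (by omega) (by omega)]
  have h1 := Real.log_le_sub_one_of_pos (div_pos hl0 hk0)
  rw [Real.log_div hl0.ne' hk0.ne'] at h1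
  have h2 : (k : ℝ) * (Real.log l - Real.log k) ≤ l - k := by
    calc _ ≤ (k : ℝ) * (l / k - 1) := by gcongr
      _ = l - k := by field_simp
  nlinarith

/-- Jensen's inequality for the logarithm of the lengths of the pieces. -/
lemma sum_one_add_log_card_level_le (hn : 0 < n) {u : EuclideanSpace ℝ (Fin n)}
    (hu : u ∈ nondecreasingSeq n) :
    ∑ c ∈ Finset.univ.image u, (1 + Real.log (level u c).card)
      ≤ numPieces u * Real.log (Real.exp 1 * n / numPieces u) := by
  have hk : 0 < numPieces u := Nat.succ_pos _
  have hk0 : (0 : ℝ) < numPieces u := by exact_mod_cast hk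
  have hn0 : (0 : ℝ) < n := by exact_mod_cast hn
  have hcard := card_image_eq_numPieces hn hu
  rw [log_exp_one_mul_div hn hk]
  have hterm (c : ℝ) (hc : c ∈ Finset.univ.image u) : 1 + Real.log (level u c).card
      ≤ (1 + Real.log n - Real.log (numPieces u)) + ((level u c).card * (numPieces u / n) - 1) := by
    have hpos : (0 : ℝ) < (level u c).card := by
      obtain ⟨i, -, rfl⟩ := Finset.mem_image.1 hc
      have hi : (i : ℕ) ∈ level u (u i) := Finset.mem_map.2 ⟨i, by simp, rfl⟩
      exact_mod_cast Finset.card_pos.2 ⟨_, hi⟩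
    have h := Real.log_le_sub_one_of_pos (mul_pos hpos (div_pos hk0 hn0))
    rw [Real.log_mul hpos.ne' (div_pos hk0 hn0).ne', Real.log_div hk0.ne' hn0.ne'] at h
    linarith
  have htotal : ∑ c ∈ Finset.univ.image u, ((level u c).card : ℝ) = n := by
    simpa using sum_sum_level u fun _ => 1
  refine (Finset.sum_le_sum hterm).trans (le_of_eq ?_)
  rw [Finset.sum_add_distrib, Finset.sum_sub_distrib (f := fun c => ((level u c).card : ℝ) * _),
    ← Finset.sum_mul, htotal]
  simp only [Finset.sum_const, hcard, nsmul_eq_mul]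
  field_simp
  ring

lemma lintegral_exp_pieceGain_le (hn : 0 < n) {u : EuclideanSpace ℝ (Fin n)}
    (hu : u ∈ nondecreasingSeq n) {t : ℝ} (ht : 0 ≤ t) (ht2 : t < 1 / 2) :
    ∫⁻ w, ENNReal.ofReal (Real.exp (t * pieceGain u w)) ∂gaussSeq
      ≤ ENNReal.ofReal (Real.exp (((√(1 - 2 * t))⁻¹ - 1)
        * (numPieces u * Real.log (Real.exp 1 * n / numPieces u)))) := by
  have hs : 1 ≤ (√(1 - 2 * t))⁻¹ :=
    (one_le_inv₀ (by rw [Real.sqrt_pos]; linarith)).2 (Real.sqrt_le_one.2 (by linarith))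
  unfold pieceGain
  rw [lintegral_exp_sum_blockGain t (level u) _ (pairwiseDisjoint_level u _)]
  refine (Finset.prod_le_prod' fun c _ => expGain_le_exp ht ht2 _).trans ?_
  rw [← ENNReal.ofReal_prod_of_nonneg fun _ _ => Real.exp_nonneg _, ← Real.exp_sum,
    ← Finset.mul_sum]
  refine ENNReal.ofReal_le_ofReal (Real.exp_le_exp.2 ?_)
  exact mul_le_mul_of_nonneg_left (sum_one_add_log_card_level_le hn hu) (by linarith)

end pieces

/-! ### From exponential moments to expectation and tail -/

section moments

variable {Ω : Type*} [MeasurableSpace Ω] {P : Measure Ω} {T : Ω → ℝ} {L : ℝ}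

lemma integrable_exp_of_lintegral_le (hT : Measurable T) {t c : ℝ}
    (h : ∫⁻ ω, ENNReal.ofReal (Real.exp (t * T ω)) ∂P ≤ ENNReal.ofReal c) (hc : 0 ≤ c) :
    Integrable (fun ω => Real.exp (t * T ω)) P ∧ ∫ ω, Real.exp (t * T ω) ∂P ≤ c := by
  refine ⟨⟨by fun_prop, ?_⟩, ?_⟩
  · rw [hasFiniteIntegral_iff_ofReal (Filter.Eventually.of_forall fun _ => Real.exp_nonneg _)]
    exact h.trans_lt ENNReal.ofReal_lt_top
  · rw [integral_eq_lintegral_of_nonneg_ae (Filter.Eventually.of_forall fun _ => Real.exp_nonneg _)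
      (by fun_prop)]
    exact ENNReal.toReal_le_of_le_ofReal hc h

/-- The mean is bounded by the derivative at `0` of the bound on the moment generating function. -/
lemma integral_le_of_lintegral_exp_le [IsProbabilityMeasure P] (hT : Measurable T)
    (hT0 : ∀ ω, 0 ≤ T ω)
    (h : ∀ t, 0 ≤ t → t < 1 / 2 → ∫⁻ ω, ENNReal.ofReal (Real.exp (t * T ω)) ∂P
      ≤ ENNReal.ofReal (Real.exp (((√(1 - 2 * t))⁻¹ - 1) * L))) :
    Integrable T P ∧ ∫ ω, T ω ∂P ≤ L := by
  have hexp (t : ℝ) (h0 : 0 ≤ t) (h1 : t < 1 / 2) :=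
    integrable_exp_of_lintegral_le hT (h t h0 h1) (Real.exp_nonneg _)
  have hint : Integrable T P := by
    refine ((hexp (1 / 4) (by norm_num) (by norm_num)).1.const_mul 4).mono'
      hT.aestronglyMeasurable (Filter.Eventually.of_forall fun ω => ?_)
    rw [Real.norm_of_nonneg (hT0 ω)]
    linarith [Real.add_one_le_exp (1 / 4 * T ω)]
  refine ⟨hint, ?_⟩
  have hderiv : HasDerivAt (fun t : ℝ => Real.exp (((√(1 - 2 * t))⁻¹ - 1) * L)) L 0 := by
    have h1 : HasDerivAt (fun t : ℝ => 1 - 2 * t) (-2) 0 := by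
      simpa using ((hasDerivAt_id (0 : ℝ)).const_mul 2).const_sub 1
    have h2 := (((h1.sqrt (by norm_num)).inv (by norm_num)).sub_const 1).mul_const L |>.exp
    convert h2 using 1 <;> simp
  have hslope := (hasDerivAt_iff_tendsto_slope.1 hderiv).mono_left
    (nhdsWithin_mono 0 fun t (ht : t ∈ Set.Ioi 0) => ne_of_gt ht)
  refine ge_of_tendsto hslope ?_
  filter_upwards [Ioo_mem_nhdsGT (show (0 : ℝ) < 1 / 2 by norm_num)] with t ht
  have h1 : ∫ ω, (1 + t * T ω) ∂P ≤ ∫ ω, Real.exp (t * T ω) ∂P :=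
    integral_mono ((integrable_const 1).add (hint.const_mul t)) (hexp t ht.1.le ht.2).1
      fun ω => by linarith [Real.add_one_le_exp (t * T ω)]
  rw [integral_add (integrable_const 1) (hint.const_mul t), integral_const_mul] at h1
  have h2 := h1.trans (hexp t ht.1.le ht.2).2
  simp only [integral_const, probReal_univ, one_smul] at h2
  rw [slope_def_field, sub_zero, le_div_iff₀ ht.1]
  norm_num
  linarith

/-- Markov's inequality for `exp (T / 4)`, using `√2 - 1 ≤ 1 / 2`. -/
lemma one_sub_exp_neg_le_of_lintegral_exp_le [IsProbabilityMeasure P] (hT : Measurable T)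
    (hL : 0 ≤ L)
    (h : ∀ t, 0 ≤ t → t < 1 / 2 → ∫⁻ ω, ENNReal.ofReal (Real.exp (t * T ω)) ∂P
      ≤ ENNReal.ofReal (Real.exp (((√(1 - 2 * t))⁻¹ - 1) * L))) (x : ℝ) :
    1 - Real.exp (-x) ≤ P.real {ω | T ω ≤ 2 * L + 4 * x} := by
  obtain ⟨h1, h2⟩ := integrable_exp_of_lintegral_le hT (h (1 / 4) (by norm_num) (by norm_num))
    (Real.exp_nonneg _)
  have h3 := measure_ge_le_exp_mul_mgf (μ := P) (X := T) (2 * L + 4 * x)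
    (show (0 : ℝ) ≤ 1 / 4 by norm_num) h1
  have hs : (√(1 - 2 * (1 / 4 : ℝ)))⁻¹ ≤ 3 / 2 := by
    rw [← Real.sqrt_inv, Real.sqrt_le_left (by norm_num)]
    norm_num
  have h4 : P.real {ω | 2 * L + 4 * x ≤ T ω} ≤ Real.exp (-x) := by
    refine h3.trans ?_
    calc _ ≤ Real.exp (-(1 / 4) * (2 * L + 4 * x)) * Real.exp (1 / 2 * L) := by
          refine mul_le_mul_of_nonneg_left (h2.trans (Real.exp_le_exp.2 ?_)) (Real.exp_nonneg _)
          exact mul_le_mul_of_nonneg_right (by linarith) hL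
      _ = Real.exp (-x) := by rw [← Real.exp_add]; congr 1; ring
  have h5 : {ω | T ω ≤ 2 * L + 4 * x}ᶜ ⊆ {ω | 2 * L + 4 * x ≤ T ω} := fun ω hω =>
    (not_le.1 (show ¬ T ω ≤ 2 * L + 4 * x from hω)).le
  have h6 := measureReal_mono (μ := P) h5
  rw [probReal_compl_eq_one_sub (measurableSet_le hT measurable_const)] at h6
  linarith

end moments

/-! ### The least squares estimator -/

section leastSquares

variable {n : ℕ}

lemma scaledNormSq_eq (u : EuclideanSpace ℝ (Fin n)) : scaledNormSq u = 1 / n * ‖u‖ ^ 2 := by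
  rw [scaledNormSq, EuclideanSpace.real_norm_sq_eq]

lemma isClosed_nondecreasingSeq (n : ℕ) : IsClosed (nondecreasingSeq n) := by
  unfold nondecreasingSeq
  simp only [Set.ofPred_forall]
  refine isClosed_iInter fun i => isClosed_iInter fun j => isClosed_iInter fun _ => ?_
  exact isClosed_le (by fun_prop) (by fun_prop)

lemma convex_nondecreasingSeq (n : ℕ) : Convex ℝ (nondecreasingSeq n) := by
  intro u hu v hv a b ha hb _ i j hij
  simp only [PiLp.add_apply, PiLp.smul_apply, smul_eq_mul]
  exact add_le_add (mul_le_mul_of_nonneg_left (hu i j hij) ha)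
    (mul_le_mul_of_nonneg_left (hv i j hij) hb)

/-- The variational inequality for a least squares estimator on a convex set. -/
lemma inner_sub_le_zero_of_mem_leastSquaresArgmin (hn : 0 < n)
    {K : Set (EuclideanSpace ℝ (Fin n))} (hK : Convex ℝ K) {y v : EuclideanSpace ℝ (Fin n)}
    (hv : v ∈ leastSquaresArgmin K y) : ∀ u ∈ K, inner ℝ (y - v) (u - v) ≤ 0 := by
  refine (norm_eq_iInf_iff_real_inner_le_zero hK hv.1).1 ?_
  have : Nonempty K := ⟨⟨v, hv.1⟩⟩
  have hn0 : (0 : ℝ) < 1 / n := by positivity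
  refine le_antisymm (le_ciInf fun w => ?_)
    (ciInf_le ⟨0, by rintro _ ⟨w, rfl⟩; exact norm_nonneg _⟩ (⟨v, hv.1⟩ : K))
  have h := hv.2 w w.2
  rw [scaledNormSq_eq, scaledNormSq_eq, mul_le_mul_iff_right₀ hn0] at h
  exact (pow_le_pow_iff_left₀ (norm_nonneg _) (norm_nonneg _) two_ne_zero).1 h

lemma continuous_of_mem_leastSquaresArgmin (hn : 0 < n)
    {K : Set (EuclideanSpace ℝ (Fin n))} (hK : Convex ℝ K)
    {μhat : EuclideanSpace ℝ (Fin n) → EuclideanSpace ℝ (Fin n)}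
    (h : ∀ y, μhat y ∈ leastSquaresArgmin K y) : Continuous μhat := by
  refine (LipschitzWith.of_dist_le_mul (K := 1) fun y z => ?_).continuous
  have h1 := inner_sub_le_zero_of_mem_leastSquaresArgmin hn hK (h y) _ (h z).1
  have h2 := inner_sub_le_zero_of_mem_leastSquaresArgmin hn hK (h z) _ (h y).1
  rw [dist_eq_norm, dist_eq_norm, NNReal.coe_one, one_mul]
  set a := μhat y - μhat z
  have h3 : inner ℝ a a ≤ inner ℝ (y - z) a := by
    rw [← neg_sub (μhat y) (μhat z), inner_neg_right] at h1
    have : y - z = (y - μhat y) - (z - μhat z) + a := by simp only [a]; abel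
    have h3 := inner_sub_left (𝕜 := ℝ) (y - μhat y) (z - μhat z) a
    rw [this, inner_add_left]
    linarith
  rw [real_inner_self_eq_norm_sq] at h3
  have h4 := h3.trans (real_inner_le_norm _ _)
  rcases (norm_nonneg a).eq_or_lt with h0 | h0
  · rw [← h0]; exact norm_nonneg _
  · rw [pow_two] at h4
    exact le_of_mul_le_mul_right h4 h0

/-- The deterministic oracle inequality: the excess of the error of the estimator over that of
`u` is at most the gain of fitting the noise by vectors that are monotone on each piece of `u`. -/
lemma scaledNormSq_sub_le (hn : 0 < n) {σ : ℝ} (hσ : 0 < σ) {μ v u : EuclideanSpace ℝ (Fin n)}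
    (w : ℕ → ℝ)
    (hv : v ∈ leastSquaresArgmin (nondecreasingSeq n)
      (μ + σ • WithLp.toLp 2 fun i : Fin n => w i))
    (hu : u ∈ nondecreasingSeq n) :
    scaledNormSq (v - μ) ≤ scaledNormSq (u - μ) + σ ^ 2 / n * pieceGain u w := by
  set ζ : EuclideanSpace ℝ (Fin n) := WithLp.toLp 2 fun i : Fin n => w i with hζ
  have h1 := inner_sub_le_zero_of_mem_leastSquaresArgmin hn (convex_nondecreasingSeq n) hv u hu
  have h2 : ‖v - μ‖ ^ 2 ≤ ‖u - μ‖ ^ 2 + 2 * σ * inner ℝ ζ (v - u) - ‖v - u‖ ^ 2 := by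
    have e1 : u - μ = (v - μ) - (v - u) := by abel
    have e2 : μ + σ • ζ - v = σ • ζ - (v - μ) := by abel
    rw [e2, ← neg_sub v u, inner_neg_right, inner_sub_left, inner_smul_left] at h1
    rw [e1, norm_sub_sq_real (v - μ)]
    simp only [conj_trivial] at h1
    linarith
  have h3 : 2 * σ * inner ℝ ζ (v - u) - ‖v - u‖ ^ 2 ≤ σ ^ 2 * pieceGain u w := by
    have h4 := sum_le_pieceGain u w (fun i => (v i - u i) / σ) fun i j hij huij => by
      have := monotone_of_mem_nondecreasingSeq hv.1 hij
      gcongr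
      exact huij.ge
    have h5 := mul_le_mul_of_nonneg_left h4 (sq_nonneg σ)
    refine le_trans (le_of_eq ?_) h5
    rw [EuclideanSpace.real_norm_sq_eq, PiLp.inner_apply, Finset.mul_sum, Finset.mul_sum,
      ← Finset.sum_sub_distrib]
    refine Finset.sum_congr rfl fun i _ => ?_
    simp [hζ]
    field_simp
  have hn0 : (0 : ℝ) < n := by exact_mod_cast hn
  rw [scaledNormSq_eq, scaledNormSq_eq]
  calc 1 / (n : ℝ) * ‖v - μ‖ ^ 2 ≤ 1 / n * (‖u - μ‖ ^ 2 + σ ^ 2 * pieceGain u w) := by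
        gcongr; linarith
    _ = _ := by ring

/-- The minimum of a squared distance plus a penalty that increases with the number of
pieces is attained: for each of the finitely many sets `J` of admissible jumps, the vectors of
`nondecreasingSeq n` that jump only in `J` form a closed set. -/
lemma exists_isLeast_penalized (hn : 0 < n) (μ : EuclideanSpace ℝ (Fin n)) {pen : ℕ → ℝ}
    (hpen : ∀ k l, 0 < k → k ≤ l → l ≤ n → pen k ≤ pen l) :
    ∃ m, IsLeast ((fun u => scaledNormSq (u - μ) + pen (numPieces u)) '' nondecreasingSeq n) m := by
  classical
  have hclosest (J : Finset (Fin n)) : ∃ v ∈ nondecreasingSeq n, numPieces v ≤ J.card + 1 ∧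
      ∀ u ∈ nondecreasingSeq n,
        {i : Fin n | ∃ j : Fin n, (j : ℕ) = (i : ℕ) + 1 ∧ u i < u j} ⊆ (J : Set (Fin n)) →
        scaledNormSq (v - μ) ≤ scaledNormSq (u - μ) := by
    let F : Set (EuclideanSpace ℝ (Fin n)) := nondecreasingSeq n ∩
      {u | ∀ i j : Fin n, (j : ℕ) = (i : ℕ) + 1 → i ∉ J → u j ≤ u i}
    have hF : IsClosed F := by
      refine (isClosed_nondecreasingSeq n).inter ?_
      simp only [Set.ofPred_forall]
      refine isClosed_iInter fun i => isClosed_iInter fun j => isClosed_iInter fun _ =>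
        isClosed_iInter fun _ => ?_
      exact isClosed_le (by fun_prop) (by fun_prop)
    obtain ⟨v, hv, hdist⟩ := hF.exists_infDist_eq_dist
      ⟨0, fun _ _ _ => le_rfl, fun _ _ _ _ => le_rfl⟩ μ
    refine ⟨v, hv.1, ?_, fun u hu hJ => ?_⟩
    · refine Nat.succ_le_succ ?_
      rw [← Set.ncard_coe_finset]
      refine Set.ncard_le_ncard (fun i hi => ?_) (Finset.finite_toSet J)
      obtain ⟨j, hj, hlt⟩ := hi
      by_contra hiJ
      exact absurd (hv.2 i j hj hiJ) (not_le.2 hlt)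
    · have huF : u ∈ F := ⟨hu, fun i j hj hiJ => by
        by_contra! hlt
        exact hiJ (hJ ⟨j, hj, hlt⟩)⟩
      have h := Metric.infDist_le_dist_of_mem (x := μ) huF
      rw [hdist, dist_comm, dist_comm μ u, dist_eq_norm, dist_eq_norm] at h
      rw [scaledNormSq_eq, scaledNormSq_eq]
      gcongr
  choose v hv hpieces hmin using hclosest
  obtain ⟨J, -, hJ⟩ := (Finset.univ : Finset (Finset (Fin n))).exists_min_image
    (fun J => scaledNormSq (v J - μ) + pen (numPieces (v J))) Finset.univ_nonempty
  refine ⟨_, ⟨v J, hv J, rfl⟩, ?_⟩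
  rintro _ ⟨u, hu, rfl⟩
  set I := (Set.toFinite
    {i : Fin n | ∃ j : Fin n, (j : ℕ) = (i : ℕ) + 1 ∧ u i < u j}).toFinset with hI
  have hcard : I.card + 1 = numPieces u := by
    rw [numPieces, hI, Set.ncard_eq_toFinset_card]
  refine (hJ I (Finset.mem_univ _)).trans (add_le_add (hmin I u hu (by simp [hI])) ?_)
  exact hpen _ _ (Nat.succ_pos _) ((hpieces I).trans hcard.le) (numPieces_le hn hu)

end leastSquares

open scoped MatrixOrder in
lemma multivariateGaussian_smul_one {n : ℕ} {σ : ℝ} (hσ : 0 ≤ σ) :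
    multivariateGaussian 0 (σ ^ 2 • (1 : Matrix (Fin n) (Fin n) ℝ))
      = gaussSeq.map fun w => σ • WithLp.toLp 2 fun i : Fin n => w i := by
  have hsqrt : CFC.sqrt (σ ^ 2 • (1 : Matrix (Fin n) (Fin n) ℝ)) = σ • 1 :=
    CFC.sqrt_unique (by rw [smul_mul_smul_comm, one_mul, pow_two])
      (smul_nonneg hσ zero_le_one)
  have hpi : gaussSeq.map (fun w (i : Fin n) => w i) = Measure.pi fun _ => gaussianReal 0 1 := by
    rw [← Measure.infinitePi_eq_pi]
    exact Measure.map_infinitePi_infinitePi_of_inj Fin.val_injective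
  rw [multivariateGaussian, hsqrt, ← map_pi_eq_stdGaussian, ← hpi,
    Measure.map_map (by fun_prop) (by fun_prop), Measure.map_map (by fun_prop) (by fun_prop)]
  congr 1
  funext w
  simp

theorem mainTheorem1 (n : ℕ) (hn : 2 ≤ n) (σ : ℝ) (hσ : 0 < σ)
    (μ : EuclideanSpace ℝ (Fin n))
    {Ω : Type*} [MeasurableSpace Ω] (P : Measure Ω) [IsProbabilityMeasure P]
    (ξ : Ω → EuclideanSpace ℝ (Fin n))
    (hξ : HasLaw ξ (multivariateGaussian 0 (σ ^ 2 • (1 : Matrix (Fin n) (Fin n) ℝ))) P)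
    (μhat : EuclideanSpace ℝ (Fin n) → EuclideanSpace ℝ (Fin n))
    (hμhat : ∀ y, μhat y ∈ leastSquaresArgmin (nondecreasingSeq n) y) :
    (∃ m : ℝ,
      IsLeast ((fun u : EuclideanSpace ℝ (Fin n) =>
        scaledNormSq (u - μ) + σ ^ 2 * (numPieces u : ℝ) / (n : ℝ) *
          Real.log (Real.exp 1 * (n : ℝ) / (numPieces u : ℝ))) '' nondecreasingSeq n) m ∧
      Integrable (fun ω => scaledNormSq (μhat (μ + ξ ω) - μ)) P ∧
      ∫ ω, scaledNormSq (μhat (μ + ξ ω) - μ) ∂P ≤ m) ∧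
    ∃ m : ℝ,
      IsLeast ((fun u : EuclideanSpace ℝ (Fin n) =>
        scaledNormSq (u - μ) + 2 * σ ^ 2 * (numPieces u : ℝ) / (n : ℝ) *
          Real.log (Real.exp 1 * (n : ℝ) / (numPieces u : ℝ))) '' nondecreasingSeq n) m ∧
      ∀ x : ℝ, 0 < x →
        1 - Real.exp (-x) ≤
          P.real {ω | scaledNormSq (μhat (μ + ξ ω) - μ) ≤ m + 4 * σ ^ 2 * x / (n : ℝ)} := by
  have hn0 : 0 < n := by omega
  have hn1 : (0 : ℝ) < n := by exact_mod_cast hn0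
  -- the law of `ξ` is that of `g`, so all probabilities can be computed under `gaussSeq`
  let f : EuclideanSpace ℝ (Fin n) → ℝ := fun z => scaledNormSq (μhat (μ + z) - μ)
  let g : (ℕ → ℝ) → EuclideanSpace ℝ (Fin n) := fun w => σ • WithLp.toLp 2 fun i : Fin n => w i
  have hf : Continuous f := by
    have := continuous_of_mem_leastSquaresArgmin hn0 (convex_nondecreasingSeq n) hμhat
    simp only [f, scaledNormSq_eq]
    fun_prop
  have hg : Measurable g := by fun_prop
  have hlaw : P.map ξ = gaussSeq.map g := hξ.map_eq.trans (multivariateGaussian_smul_one hσ.le)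
  have hdet (u : EuclideanSpace ℝ (Fin n)) (hu : u ∈ nondecreasingSeq n) (w : ℕ → ℝ) :
      f (g w) ≤ scaledNormSq (u - μ) + σ ^ 2 / n * pieceGain u w :=
    scaledNormSq_sub_le hn0 hσ w (hμhat _) hu
  have hpen (c : ℝ) (hc : 0 ≤ c) (k l : ℕ) (hk : 0 < k) (hkl : k ≤ l) (hl : l ≤ n) :
      c * k / n * Real.log (Real.exp 1 * n / k) ≤ c * l / n * Real.log (Real.exp 1 * n / l) := by
    have h := mul_le_mul_of_nonneg_left (mul_log_mono hk hkl hl) (div_nonneg hc hn1.le)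
    calc _ = c / n * (k * Real.log (Real.exp 1 * n / k)) := by ring
      _ ≤ _ := h
      _ = _ := by ring
  constructor
  · obtain ⟨m, hm⟩ := exists_isLeast_penalized hn0 μ
      (pen := fun k => σ ^ 2 * k / n * Real.log (Real.exp 1 * n / k)) (hpen _ (sq_nonneg σ))
    refine ⟨m, hm, ?_⟩
    obtain ⟨u, hu, rfl⟩ := hm.1
    obtain ⟨hint, hle⟩ := integral_le_of_lintegral_exp_le (measurable_pieceGain u)
      (pieceGain_nonneg u) fun t ht ht2 => lintegral_exp_pieceGain_le hn0 hu ht ht2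
    have hbound : Integrable (fun w => scaledNormSq (u - μ) + σ ^ 2 / n * pieceGain u w) gaussSeq :=
      (integrable_const _).add (hint.const_mul _)
    have hfg : Integrable (fun w => f (g w)) gaussSeq := by
      refine hbound.mono' (hf.measurable.comp hg).aestronglyMeasurable
        (Filter.Eventually.of_forall fun w => ?_)
      rw [Real.norm_of_nonneg (by simp only [f, scaledNormSq_eq]; positivity)]
      exact hdet u hu w
    have hfm (ν : Measure (EuclideanSpace ℝ (Fin n))) : AEStronglyMeasurable f ν :=
      hf.aestronglyMeasurable
    refine ⟨?_, ?_⟩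
    · have h : Integrable f (P.map ξ) := by
        rw [hlaw]
        exact (integrable_map_measure (hfm _) hg.aemeasurable).2 hfg
      exact (integrable_map_measure (hfm _) hξ.aemeasurable).1 h
    · calc ∫ ω, f (ξ ω) ∂P = ∫ w, f (g w) ∂gaussSeq := by
            rw [← integral_map hξ.aemeasurable (hfm _), hlaw, integral_map hg.aemeasurable (hfm _)]
        _ ≤ ∫ w, (scaledNormSq (u - μ) + σ ^ 2 / n * pieceGain u w) ∂gaussSeq :=
          integral_mono hfg hbound (hdet u hu)
        _ = scaledNormSq (u - μ) + σ ^ 2 / n * ∫ w, pieceGain u w ∂gaussSeq := by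
          rw [integral_add (integrable_const _) (hint.const_mul _), integral_const_mul]
          simp
        _ ≤ scaledNormSq (u - μ)
            + σ ^ 2 / n * (numPieces u * Real.log (Real.exp 1 * n / numPieces u)) := by
          gcongr
        _ = _ := by ring
  · obtain ⟨m, hm⟩ := exists_isLeast_penalized hn0 μ
      (pen := fun k => 2 * σ ^ 2 * k / n * Real.log (Real.exp 1 * n / k))
      (hpen _ (by positivity))
    refine ⟨m, hm, fun x _ => ?_⟩
    obtain ⟨u, hu, rfl⟩ := hm.1
    have hL : 0 ≤ numPieces u * Real.log (Real.exp 1 * n / numPieces u) := by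
      have hk : 0 < numPieces u := Nat.succ_pos _
      have := mul_log_mono (n := n) (k := 1) one_pos hk (numPieces_le hn0 hu)
      refine le_trans ?_ this
      rw [log_exp_one_mul_div hn0 one_pos]
      simp only [Nat.cast_one, Real.log_one]
      have := Real.log_natCast_nonneg n
      linarith
    refine (one_sub_exp_neg_le_of_lintegral_exp_le (measurable_pieceGain u) hL
      (fun t ht ht2 => lintegral_exp_pieceGain_le hn0 hu ht ht2) x).trans ?_
    set c := scaledNormSq (u - μ) + 2 * σ ^ 2 * numPieces u / n *
      Real.log (Real.exp 1 * n / numPieces u) + 4 * σ ^ 2 * x / n with hc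
    have hset : MeasurableSet {z | f z ≤ c} := measurableSet_le hf.measurable measurable_const
    have h1 : P.real {ω | f (ξ ω) ≤ c} = gaussSeq.real {w | f (g w) ≤ c} := by
      have h2 := map_measureReal_apply_of_aemeasurable hξ.aemeasurable hset
      have h3 := map_measureReal_apply hg hset (μ := gaussSeq)
      rw [hlaw] at h2
      exact h2.symm.trans h3
    refine le_trans ?_ h1.ge
    refine measureReal_mono fun w hw => (hdet u hu w).trans ?_
    have hw : pieceGain u w
      ≤ 2 * (numPieces u * Real.log (Real.exp 1 * n / numPieces u)) + 4 * x := hw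
    calc scaledNormSq (u - μ) + σ ^ 2 / n * pieceGain u w ≤ scaledNormSq (u - μ) + σ ^ 2 / n *
          (2 * (numPieces u * Real.log (Real.exp 1 * n / numPieces u)) + 4 * x) := by gcongr
      _ = c := by rw [hc]; ring
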